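/- **Model.** An $m\times n$ board is the set $\{1,\dots,m\}\times\{1,\dots,n\}\subset\mathbb Z^2$ in which some locations are blocked and the others are open. Fix a finite set of attachment labels and an affinity function $G$ on pairs of labels with values in $\{0,1\}$; labels $a,b$ attract each other if $G(a,b)=G(b,a)=1$. A tile is a pair (coordinate, label); two tiles are bonded if their coordinates are at distance $1$ and their labels attract each other. A configuration is a board together with tiles on pairwise distinct open locations; its polyominoes are the maximal sets of tiles connected through bonds, and its size is the number $mn$ of locations of its board. In a step in direction $d\in\{N,E,S,W\}$ every polyomino moves one unit in direction $d$, except those that would overlap a blocked location or, recursively, a polyomino that cannot move; a polyomino carried off the board is removed; newly bonded polyominoes merge. A tilt in direction $d$ repeats steps in direction $d$ until the configuration no longer changes. A shape is a nonempty connected (with respect to unit-distance adjacency) subset of $\mathbb Z^2$. A configuration weakly represents a shape $S$ if the coordinates of one of its polyominoes form exactly a translate of $S$ and every other polyomino is sand, i.e. a single tile whose label attracts no label. A configuration $C$ is weakly universal for a set $U$ of shapes if for every $u\in U$ some configuration that weakly represents $u$ can be reached from $C$ by a sequence of tilts. **Theorem.** There are a finite set of labels, an affinity function and a constant $c$ such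 that for all integers $h,w\ge 1$ there is a configuration $C$ of size at most $c\,hw$ that is weakly universal for the set of all shapes $u\subseteq\{1,\dots,h\}\times\{1,\dots,w\}$; moreover, for every such $u$ there is a sequence of at most $c\,hw$ tilts that turns $C$ into a configuration weakly representing $u$. -/

import Mathlib

namespace TiltAssembly

/-- Points of the square lattice. -/
abbrev Cell := ℤ × ℤ

/-- The four tilt directions. -/
inductive Dir
  | N | E | S | W

/-- The unit vector of a direction. -/
def Dir.vec : Dir → Cell
  | .N => (0, 1)
  | .E => (1, 0)
  | .S => (0, -1)
  | .W => (-1, 0)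

/-- The square lattice as a graph: two points are adjacent when they are at distance one. -/
def grid : SimpleGraph Cell where
  Adj p q := |p.1 - q.1| + |p.2 - q.2| = 1
  symm := ⟨fun p q h => by rw [abs_sub_comm q.1, abs_sub_comm q.2]; exact h⟩
  loopless := ⟨fun p h => by simp at h⟩

/-- An `m × n` board: the locations `{1, …, m} × {1, …, n}`, some of which are blocked. -/
structure Board where
  m : ℕ
  n : ℕ
  blocked : Set Cell
  blocked_subset : blocked ⊆ Set.Icc 1 (m : ℤ) ×ˢ Set.Icc 1 (n : ℤ)

/-- All locations of the board. -/
def Board.locations (B : Board) : Set Cell := Set.Icc 1 (B.m : ℤ) ×ˢ Set.Icc 1 (B.n : ℤ)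

/-- The open locations: those that are not blocked. -/
def Board.openCells (B : Board) : Set Cell := B.locations \ B.blocked

/-- A tile: a coordinate together with an attachment label. -/
abbrev Tile (L : Type) := Cell × L

/-- Two labels attract each other under the affinity function `G`. -/
def Attract {L : Type} (G : L → L → Bool) (a b : L) : Prop := G a b = true ∧ G b a = true

/-- Two tiles are bonded: they are adjacent and their labels attract each other. -/
def Bonded {L : Type} (G : L → L → Bool) (s t : Tile L) : Prop :=
  grid.Adj s.1 t.1 ∧ Attract G s.2 t.2

/-- A configuration: a board with non-overlapping tiles on open locations. Adjacent bonded tiles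
always belong to the same polyomino, so the tiles determine the polyominoes
(see `Configuration.polyominoes`). -/
@[ext]
structure Configuration {L : Type} (G : L → L → Bool) where
  board : Board
  tiles : Set (Tile L)
  mem_open : ∀ t ∈ tiles, t.1 ∈ board.openCells
  no_overlap : ∀ s ∈ tiles, ∀ t ∈ tiles, s.1 = t.1 → s = t

namespace Configuration

variable {L : Type} {G : L → L → Bool}

/-- The size of a configuration: the number of locations of its board, blocked ones included. -/
def size (C : Configuration G) : ℕ := C.board.m * C.board.n

/-- The graph of bonds between the tiles of a configuration. -/
def bondGraph (C : Configuration G) : SimpleGraph (Tile L) where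
  Adj s t := s ∈ C.tiles ∧ t ∈ C.tiles ∧ Bonded G s t
  symm := ⟨fun _ _ h => ⟨h.2.1, h.1, h.2.2.1.symm, h.2.2.2.2, h.2.2.2.1⟩⟩
  loopless := ⟨fun _ h => grid.irrefl h.2.2.1⟩

/-- The polyominoes of a configuration: the maximal sets of tiles connected through bonds. -/
def polyominoes (C : Configuration G) : Set (Set (Tile L)) :=
  {P | ∃ t ∈ C.tiles, P = {s | C.bondGraph.Reachable t s}}

/-- The polyominoes that cannot move by one unit in direction `d`: those whose translate would
overlap a blocked location or a polyomino that has itself been found unable to move. -/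
inductive Stuck (C : Configuration G) (d : Dir) : Set (Tile L) → Prop
  | wall (P : Set (Tile L)) (t : Tile L) (hP : P ∈ C.polyominoes) (ht : t ∈ P)
      (h : t.1 + d.vec ∈ C.board.blocked) : Stuck C d P
  | poly (P Q : Set (Tile L)) (t s : Tile L) (hP : P ∈ C.polyominoes) (hQ : Stuck C d Q)
      (ht : t ∈ P) (hs : s ∈ Q) (h : t.1 + d.vec = s.1) : Stuck C d P

/-- The tiles after one step in direction `d`: stuck polyominoes stay, the others are translated
by one unit, and a polyomino that is carried off the board is removed. -/
def stepTiles (C : Configuration G) (d : Dir) : Set (Tile L) :=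
  {s | ∃ P ∈ C.polyominoes, C.Stuck d P ∧ s ∈ P} ∪
  {s | ∃ P ∈ C.polyominoes, ¬ C.Stuck d P ∧ (∀ t ∈ P, t.1 + d.vec ∈ C.board.locations) ∧
    ∃ t ∈ P, s = (t.1 + d.vec, t.2)}

theorem mem_tiles_of_mem {C : Configuration G} {P : Set (Tile L)} (hP : P ∈ C.polyominoes)
    {s : Tile L} (hs : s ∈ P) : s ∈ C.tiles := by
  obtain ⟨t, ht, rfl⟩ := hP
  have h : C.bondGraph.Reachable s t := SimpleGraph.Reachable.symm hs
  obtain ⟨p⟩ := h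
  cases p with
  | nil => exact ht
  | cons e _ => exact e.1

/-- One step in direction `d`. Newly bonded tiles are merged automatically, because polyominoes
are read off from the bonds. -/
def step (d : Dir) (C : Configuration G) : Configuration G where
  board := C.board
  tiles := C.stepTiles d
  mem_open := by
    rintro s (⟨P, hP, -, hs⟩ | ⟨P, hP, hn, hb, t, ht, rfl⟩)
    · exact C.mem_open s (mem_tiles_of_mem hP hs)
    · exact ⟨hb t ht, fun h => hn (Stuck.wall P t hP ht h)⟩
  no_overlap := by
    rintro s (⟨P, hP, hst, hs⟩ | ⟨P, hP, hn, hb, s', hs', rfl⟩) t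
      (⟨Q, hQ, hst', ht⟩ | ⟨Q, hQ, hn', hb', t', ht', rfl⟩) h
    · exact C.no_overlap s (mem_tiles_of_mem hP hs) t (mem_tiles_of_mem hQ ht) h
    · exact absurd (Stuck.poly Q P t' s hQ hst ht' hs h.symm) hn'
    · exact absurd (Stuck.poly P Q s' t hP hst' hs' ht h) hn
    · have e := C.no_overlap s' (mem_tiles_of_mem hP hs') t' (mem_tiles_of_mem hQ ht')
        (add_right_cancel h)
      rw [e]

/-- A configuration is `d`-terminal when a step in direction `d` does not change it. -/
def Terminal (d : Dir) (C : Configuration G) : Prop := step d C = C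

/-- `C'` is the result of a tilt of `C` in direction `d`: steps in direction `d` are repeated until
the configuration is `d`-terminal. -/
def Tilt (d : Dir) (C C' : Configuration G) : Prop :=
  ∃ k : ℕ, (step d)^[k] C = C' ∧ Terminal d C'

/-- `C` can be reconfigured into `C'` in one move. -/
def ReconfigOne (C C' : Configuration G) : Prop := ∃ d : Dir, Tilt d C C'

/-- `C` can be reconfigured into `C'` by a sequence of tilts. -/
def Reconfig (C C' : Configuration G) : Prop := Relation.TransGen ReconfigOne C C'

/-- The tilt sequence `D` turns `C` into `C'`. -/
def TiltSequence : List Dir → Configuration G → Configuration G → Prop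
  | [], C, C' => C = C'
  | d :: D, C, C' => ∃ C₁, Tilt d C C₁ ∧ TiltSequence D C₁ C'

/-- `C` is universal for a set of configurations. -/
def UniversalFor (C : Configuration G) (𝒞 : Set (Configuration G)) : Prop :=
  ∀ C' ∈ 𝒞, Reconfig C C'

end Configuration

/-- A shape: a (nonempty) connected set of lattice points. -/
def IsShape (S : Set Cell) : Prop := (grid.induce S).Connected

/-- Sand: a single tile whose label attracts no label at all. -/
def IsSand {L : Type} (G : L → L → Bool) (P : Set (Tile L)) : Prop :=
  ∃ t : Tile L, P = {t} ∧ ∀ b : L, ¬ Attract G t.2 b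

namespace Configuration

variable {L : Type} {G : L → L → Bool}

/-- `C` weakly represents `S`: the coordinates of one polyomino are exactly a translate of `S`, and
every other polyomino is a helper, that is, a sand tile. -/
def WeaklyRepresents (C : Configuration G) (S : Set Cell) : Prop :=
  ∃ P ∈ C.polyominoes, (∃ v : Cell, Prod.fst '' P = (fun p => p + v) '' S) ∧
    ∀ Q ∈ C.polyominoes, Q ≠ P → IsSand G Q

/-- `C` is weakly universal for a set `U` of shapes. -/
def WeaklyUniversal (C : Configuration G) (U : Set (Set Cell)) : Prop :=
  ∃ 𝒞 : Set (Configuration G), (∀ u ∈ U, ∃ C' ∈ 𝒞, WeaklyRepresents C' u) ∧ UniversalFor C 𝒞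

end Configuration

/-- The shapes contained in the box `{1, …, h} × {1, …, w}`. -/
def shapesInBox (h w : ℕ) : Set (Set Cell) :=
  {u | IsShape u ∧ u ⊆ Set.Icc 1 (h : ℤ) ×ˢ Set.Icc 1 (w : ℤ)}

end TiltAssembly

/-! ### Tilts described by prescribed displacements of tiles. -/

namespace TiltAssembly
namespace Configuration

variable {L : Type} {G : L → L → Bool}

/-! Two labels suffice: `true` is sticky and attracts itself, `false` is sand. A fixed machine
builds a full rectangle of tiles, row by row, whose sticky tiles sit exactly on the target shape. By
`weaklyRepresents_of_sticky` such a rectangle weakly represents the shape, since the sticky tiles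
bond into one polyomino and all sand stays single.

The machine must allow a free choice of every label. Tiles wait in a queue; W, S drops its first
tile through a hole. Then W throws this tile off the board, E restoring the queue (`moves_discard`),
whereas E, S, E packs it into a slot (`moves_accept`). A useful supply row alternates sand and
sticky tiles, so each consecutive pair offers both labels: one is accepted, the other discarded
(`exists_moves_fill`). A full slot is carried by N, E, N to the underside of the rows already built
(`moves_deliver_full`). The same tilts lift the reservoir so that its top row enters a corridor, and
W, S sends that row to the queue (`moves_supply`). Each tile costs a bounded number of tilts and the
board exceeds the target by constant factors only, which gives both linear bounds.

Unwanted bonds are excluded by the supply pattern: no two horizontal neighbours are both sticky, so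
a dropped tile separates from the queue, and all-sand rows between the useful ones let the top row
slide off the reservoir (`compatible_release`, `compatible_supply`).

Each tilt is verified by naming in advance the distance every tile travels
(`exists_tilt_of_displacement`). Tiles are grouped into rectangular blocks moving rigidly
(`exists_tilt_blocks_filter`). Blocks need not be polyominoes and may be cut anew between tilts, so
the bonds that the target creates inside a block never have to be analysed. -/

theorem mem_polyominoes_of_mem {C : Configuration G} {t : Tile L} (ht : t ∈ C.tiles) :
    {s | C.bondGraph.Reachable t s} ∈ C.polyominoes := ⟨t, ht, rfl⟩

/-- A property that is transported along bonds holds on a whole polyomino once it holds at one of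
its tiles. -/
theorem forall_mem_polyomino {C : Configuration G} {φ : Tile L → Prop}
    (hφ : ∀ s t, C.bondGraph.Adj s t → φ s → φ t) {P : Set (Tile L)} (hP : P ∈ C.polyominoes)
    {s t : Tile L} (hs : s ∈ P) (ht : t ∈ P) (h : φ s) : φ t := by
  obtain ⟨r, -, rfl⟩ := hP
  have hst : C.bondGraph.Reachable s t := (SimpleGraph.Reachable.symm hs).trans ht
  obtain ⟨w⟩ := hst
  clear hs ht
  induction w with
  | nil => exact h
  | cons e _ ih => exact ih (hφ _ _ e h)

/-- The coordinate of a point in direction `d`. -/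
def progress (d : Dir) (p : Cell) : ℤ := p.1 * d.vec.1 + p.2 * d.vec.2

theorem progress_add (d : Dir) (p : Cell) : progress d (p + d.vec) = progress d p + 1 := by
  cases d <;> simp [progress, Dir.vec] <;> ring

theorem progress_le {B : Board} (d : Dir) {p : Cell} (hp : p ∈ B.locations) :
    progress d p ≤ B.m + B.n := by
  obtain ⟨⟨h1, h2⟩, h3, h4⟩ := hp
  cases d <;> simp [progress, Dir.vec] <;> omega

/-- The locations of a board are convex in the direction `d`. -/
theorem add_smul_mem_locations {B : Board} (d : Dir) {p : Cell} {a b : ℕ} (hab : a ≤ b)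
    (h0 : p ∈ B.locations) (hb : p + b • d.vec ∈ B.locations) : p + a • d.vec ∈ B.locations := by
  simp only [Board.locations, Set.mem_prod, Set.mem_Icc] at *
  cases d <;> simp [Dir.vec] at * <;> omega

section Displacement

variable (d : Dir) {ι : Type} (p : ι → Cell) (l : ι → L) (n : ι → ℕ)

/-- The tiles after `k` steps, when tile `i` moves by `n i` units and then stops. -/
def displaced (B : Board) (k : ℕ) : Set (Tile L) :=
  {t | ∃ i, t = (p i + min k (n i) • d.vec, l i) ∧ t.1 ∈ B.locations}

variable {d p l n}

/-- At time `k` a tile is stuck exactly when `n i ≤ k`. A tile with distance left meets no wall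
(`hfree`), runs only into moving tiles (`hcoll`) and is bonded only to moving tiles (`hbond`), so
`Stuck` cannot reach it; a tile at rest is blocked through its support (`hrest`). -/
theorem step_displaced (C : Configuration G) (k : ℕ)
    (htiles : C.tiles = displaced d p l n C.board k)
    (hloc : ∀ i, p i ∈ C.board.locations)
    (hfree : ∀ i, k < n i → p i + (k + 1) • d.vec ∉ C.board.blocked)
    (hcoll : ∀ i j, k < n i → p i + (k + 1) • d.vec = p j + min k (n j) • d.vec → k < n j)
    (hbond : ∀ i j, p i + min k (n i) • d.vec ∈ C.board.locations →
      p j + min k (n j) • d.vec ∈ C.board.locations →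
      grid.Adj (p i + min k (n i) • d.vec) (p j + min k (n j) • d.vec) →
      Attract G (l i) (l j) → (k < n i → k < n j) ∧
        (p i + min (k + 1) (n i) • d.vec ∈ C.board.locations →
          p j + min (k + 1) (n j) • d.vec ∈ C.board.locations))
    (hrest : ∀ i, p i + n i • d.vec ∈ C.board.locations →
      p i + (n i + 1) • d.vec ∈ C.board.blocked ∨
        ∃ j, n j ≤ n i ∧ p j + n j • d.vec = p i + (n i + 1) • d.vec ∧
          p j + n j • d.vec ∈ C.board.locations) :
    (step d C).tiles = displaced d p l n C.board (k + 1) := by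
  have hmove : ∀ i, k < n i → p i + min k (n i) • d.vec + d.vec = p i + (k + 1) • d.vec := by
    intro i hi
    rw [min_eq_left hi.le, succ_nsmul, add_assoc]
  have hmove' : ∀ i, k < n i → p i + min (k + 1) (n i) • d.vec = p i + (k + 1) • d.vec := by
    intro i hi
    rw [min_eq_left (by omega)]
  have hstay : ∀ i, n i ≤ k → p i + min k (n i) • d.vec = p i + n i • d.vec := by
    intro i hi
    rw [min_eq_right hi]
  have hstay' : ∀ i, n i ≤ k → p i + min (k + 1) (n i) • d.vec = p i + n i • d.vec := by
    intro i hi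
    rw [min_eq_right (by omega)]
  have hmem : ∀ t ∈ C.tiles, ∃ i, t = (p i + min k (n i) • d.vec, l i) ∧
      t.1 ∈ C.board.locations := fun t ht => by rwa [htiles] at ht
  have htile : ∀ i, p i + min k (n i) • d.vec ∈ C.board.locations →
      ((p i + min k (n i) • d.vec, l i) : Tile L) ∈ C.tiles := fun i hi => by
    rw [htiles]; exact ⟨i, rfl, hi⟩
  -- stuck tiles have already covered their displacement
  have hφ : ∀ s t, C.bondGraph.Adj s t →
      (∀ i, s = (p i + min k (n i) • d.vec, l i) → n i ≤ k) →
      (∀ i, t = (p i + min k (n i) • d.vec, l i) → n i ≤ k) := by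
    rintro s t ⟨hs, ht, hadj, hatt⟩ h i rfl
    have hil : p i + min k (n i) • d.vec ∈ C.board.locations := (C.mem_open _ ht).1
    obtain ⟨j, rfl, hjl⟩ := hmem s hs
    by_contra hlt
    have := (hbond i j hil hjl hadj.symm ⟨hatt.2, hatt.1⟩).1 (by omega)
    have := h j rfl
    omega
  have hstuck : ∀ P, C.Stuck d P → ∀ t ∈ P, ∀ i, t = (p i + min k (n i) • d.vec, l i) →
      n i ≤ k := by
    intro P h
    induction h with
    | wall P t hP ht h =>
      intro s hs
      refine forall_mem_polyomino hφ hP ht hs ?_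
      rintro i rfl
      by_contra hlt
      exact hfree i (by omega) (by rw [← hmove i (by omega)]; exact h)
    | poly P Q t s hP hQ ht hs h ih =>
      intro s' hs'
      refine forall_mem_polyomino hφ hP ht hs' ?_
      rintro i rfl
      by_contra hlt
      have hsC : s ∈ C.tiles := by
        cases hQ with
        | wall _ _ hQ => exact mem_tiles_of_mem hQ hs
        | poly _ _ _ _ hQ => exact mem_tiles_of_mem hQ hs
      obtain ⟨j, rfl, -⟩ := hmem s hsC
      have := hcoll i j (by omega) (by rw [← hmove i (by omega)]; exact h)
      have := ih _ hs j rfl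
      omega
  -- The support of a tile lies one unit further in direction `d`, so induction on the remaining
  -- room before the edge of the board follows a chain of supports to a wall.
  have hstuck' : ∀ m : ℕ, ∀ i, n i ≤ k → p i + n i • d.vec ∈ C.board.locations →
      ((C.board.m + C.board.n : ℤ) - progress d (p i + n i • d.vec)).toNat = m →
      C.Stuck d {s | C.bondGraph.Reachable (p i + min k (n i) • d.vec, l i) s} := by
    intro m
    induction m using Nat.strong_induction_on with
    | _ m ih =>
      intro i hi hl hm
      have hti := htile i (by rwa [hstay i hi])
      rcases hrest i hl with h | ⟨j, hj, he, hjl⟩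
      · refine Stuck.wall _ _ (mem_polyominoes_of_mem hti) (SimpleGraph.Reachable.refl _) ?_
        dsimp only
        rwa [hstay i hi, add_assoc, ← succ_nsmul]
      · have hp : progress d (p j + n j • d.vec) = progress d (p i + n i • d.vec) + 1 := by
          rw [he, succ_nsmul, ← add_assoc, progress_add]
        have hle := progress_le d hjl
        refine Stuck.poly _ _ _ _ (mem_polyominoes_of_mem hti) (ih _ ?_ j (hj.trans hi) hjl rfl)
          (SimpleGraph.Reachable.refl _) (SimpleGraph.Reachable.refl _) ?_
        · omega
        · dsimp only
          rw [hstay i hi, hstay j (hj.trans hi), he, succ_nsmul, add_assoc]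
  ext t
  constructor
  · rintro (⟨P, hP, hst, ht⟩ | ⟨P, hP, hn, hb, s, hs, rfl⟩)
    · obtain ⟨i, rfl, hl⟩ := hmem t (mem_tiles_of_mem hP ht)
      have hi := hstuck P hst _ ht i rfl
      exact ⟨i, by rw [hstay i hi, hstay' i hi], hl⟩
    · obtain ⟨i, rfl, hl⟩ := hmem s (mem_tiles_of_mem hP hs)
      have hi : k < n i := by
        by_contra hi
        have hi : n i ≤ k := by omega
        have := hstuck' _ i hi (by rwa [← hstay i hi]) rfl
        obtain ⟨r, hr, rfl⟩ := hP
        apply hn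
        convert this using 2
        ext z
        exact ⟨fun h => (SimpleGraph.Reachable.symm hs).trans h,
          fun h => SimpleGraph.Reachable.trans hs h⟩
      refine ⟨i, ?_, hb _ hs⟩
      rw [hmove' i hi, ← hmove i hi]
  · rintro ⟨i, rfl, hl⟩
    have hl' : p i + min k (n i) • d.vec ∈ C.board.locations :=
      add_smul_mem_locations d (by omega) (hloc i) hl
    have hti := htile i hl'
    have hP := mem_polyominoes_of_mem hti
    rcases le_or_gt (n i) k with hi | hi
    · refine Or.inl ⟨_, hP, hstuck' _ i hi (by rwa [← hstay i hi]) rfl, ?_⟩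
      rw [hstay' i hi, ← hstay i hi]
      exact SimpleGraph.Reachable.refl _
    · refine Or.inr ⟨_, hP, fun h => ?_, ?_, _, SimpleGraph.Reachable.refl _, ?_⟩
      · have := hstuck _ h _ (SimpleGraph.Reachable.refl _) i rfl
        omega
      · intro s hs
        -- A polyomino is removed as a whole, so one tile remaining on the board must force this for
        -- every tile bonded to it.
        have hψ : ∀ s t, C.bondGraph.Adj s t →
            (∃ j, s = (p j + min k (n j) • d.vec, l j) ∧ k < n j ∧
              p j + min (k + 1) (n j) • d.vec ∈ C.board.locations) →
            (∃ j, t = (p j + min k (n j) • d.vec, l j) ∧ k < n j ∧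
              p j + min (k + 1) (n j) • d.vec ∈ C.board.locations) := by
          rintro s t ⟨hs, ht, hadj, hatt⟩ ⟨j, rfl, hj, hjl⟩
          obtain ⟨j', rfl, hl'⟩ := hmem t ht
          have := hbond j j' (C.mem_open _ hs).1 hl' hadj hatt
          exact ⟨j', rfl, this.1 hj, this.2 hjl⟩
        obtain ⟨j, rfl, hj, hjl⟩ := forall_mem_polyomino hψ hP
          (SimpleGraph.Reachable.refl _) hs ⟨i, rfl, hi, hl⟩
        dsimp only
        rwa [hmove j hj, ← hmove' j hj]
      · rw [hmove' i hi, ← hmove i hi]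

/-- If every tile `i` can move freely by `n i` units in direction `d` and is supported there, then
a tilt in direction `d` moves it by exactly `n i` units; the tiles that leave the board vanish. -/
theorem exists_tilt_of_displacement (C : Configuration G) (N : ℕ) (hN : ∀ i, n i ≤ N)
    (htiles : C.tiles = {t | ∃ i, t = (p i, l i)})
    (hfree : ∀ i k, k < n i → p i + (k + 1) • d.vec ∉ C.board.blocked)
    (hcoll : ∀ i j k, k < n i → p i + (k + 1) • d.vec = p j + min k (n j) • d.vec → k < n j)
    (hbond : ∀ i j k, p i + min k (n i) • d.vec ∈ C.board.locations →
      p j + min k (n j) • d.vec ∈ C.board.locations →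
      grid.Adj (p i + min k (n i) • d.vec) (p j + min k (n j) • d.vec) →
      Attract G (l i) (l j) → (k < n i → k < n j) ∧
        (p i + min (k + 1) (n i) • d.vec ∈ C.board.locations →
          p j + min (k + 1) (n j) • d.vec ∈ C.board.locations))
    (hrest : ∀ i, p i + n i • d.vec ∈ C.board.locations →
      p i + (n i + 1) • d.vec ∈ C.board.blocked ∨
        ∃ j, n j ≤ n i ∧ p j + n j • d.vec = p i + (n i + 1) • d.vec ∧
          p j + n j • d.vec ∈ C.board.locations) :
    ∃ C', Tilt d C C' ∧ C'.board = C.board ∧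
      C'.tiles = {t | ∃ i, t = (p i + n i • d.vec, l i) ∧ t.1 ∈ C.board.locations} := by
  have hloc : ∀ i, p i ∈ C.board.locations := fun i =>
    (C.mem_open (p i, l i) (by rw [htiles]; exact ⟨i, rfl⟩)).1
  have key : ∀ k, ((step d)^[k] C).board = C.board ∧
      ((step d)^[k] C).tiles = displaced d p l n C.board k := by
    intro k
    induction k with
    | zero =>
      refine ⟨rfl, ?_⟩
      ext t
      simp only [Function.iterate_zero, id, htiles, displaced, Nat.zero_min, zero_smul, add_zero]
      exact ⟨fun ⟨i, h⟩ => ⟨i, h, h ▸ hloc i⟩, fun ⟨i, h, _⟩ => ⟨i, h⟩⟩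
    | succ k ih =>
      rw [Function.iterate_succ_apply']
      obtain ⟨hb, ht⟩ := ih
      refine ⟨hb, ?_⟩
      rw [← hb] at ht ⊢
      exact step_displaced _ k ht (by rwa [hb]) (fun i => by rw [hb]; exact hfree i k)
        (fun i j => hcoll i j k) (fun i j => by rw [hb]; exact hbond i j k) (by rwa [hb])
  have hend : ∀ k, N ≤ k → displaced d p l n C.board k =
      {t | ∃ i, t = (p i + n i • d.vec, l i) ∧ t.1 ∈ C.board.locations} := by
    intro k hk
    simp only [displaced, min_eq_right ((hN _).trans hk)]
  -- `N` bounds all displacements, so nothing changes after `N` steps and the configuration is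
  -- terminal.
  refine ⟨(step d)^[N] C, ⟨N, rfl, ?_⟩, (key N).1, (key N).2.trans (hend N le_rfl)⟩
  have h1 := key (N + 1)
  rw [Function.iterate_succ_apply'] at h1
  refine Configuration.ext (h1.1.trans (key N).1.symm) ?_
  rw [h1.2, (key N).2, hend N le_rfl, hend (N + 1) (by omega)]

end Displacement
end Configuration
end TiltAssembly

/-! ### Rigid motion of rectangular blocks. -/

namespace TiltAssembly

theorem grid_adj_iff {p q : Cell} : grid.Adj p q ↔
    p.1 = q.1 ∧ (p.2 = q.2 + 1 ∨ q.2 = p.2 + 1) ∨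
    p.2 = q.2 ∧ (p.1 = q.1 + 1 ∨ q.1 = p.1 + 1) := by
  change |p.1 - q.1| + |p.2 - q.2| = 1 ↔ _
  rcases abs_cases (p.1 - q.1) with ⟨e1, _⟩ | ⟨e1, _⟩ <;>
  rcases abs_cases (p.2 - q.2) with ⟨e2, _⟩ | ⟨e2, _⟩ <;> omega

/-- A rectangular block of tiles with lower left corner `(x, y)`. -/
structure Block (L : Type) where
  x : ℤ
  y : ℤ
  w : ℕ
  h : ℕ
  lab : ℕ → ℕ → L

namespace Block

variable {L : Type} {G : L → L → Bool}

/-- The position of the tile `(i, j)` of a block after `k` units of motion in direction `d`. -/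
def cell (b : Block L) (d : Dir) (i j k : ℕ) : Cell :=
  (b.x + i + k * d.vec.1, b.y + j + k * d.vec.2)

def tiles (b : Block L) : Set (Tile L) :=
  {t | ∃ i j : ℕ, i < b.w ∧ j < b.h ∧ t = ((b.x + i, b.y + j), b.lab i j)}

/-- The block moved by `n` units in direction `d`. -/
def shift (d : Dir) (b : Block L) (n : ℕ) : Block L :=
  { b with x := b.x + n * d.vec.1, y := b.y + n * d.vec.2 }

/-- The tile `(i, j)` is on the side of the block that faces direction `d`. -/
def Front (b : Block L) (i j : ℕ) : Dir → Prop
  | .N => j + 1 = b.h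
  | .E => i + 1 = b.w
  | .S => j = 0
  | .W => i = 0

/-- Two blocks that move in direction `d` by the given distances neither run into each other nor
form a bond before both have stopped. -/
def Compatible (G : L → L → Bool) (d : Dir) (m m' : Block L × ℕ) : Prop :=
  ∀ i < m.1.w, ∀ j < m.1.h, ∀ i' < m'.1.w, ∀ j' < m'.1.h, ∀ k : ℕ,
    (grid.Adj (m.1.cell d i j (min k m.2)) (m'.1.cell d i' j' (min k m'.2)) →
      Attract G (m.1.lab i j) (m'.1.lab i' j') → m.2 ≤ k ∧ m'.2 ≤ k) ∧
    (k < m.2 → m.1.cell d i j (k + 1) = m'.1.cell d i' j' (min k m'.2) → k < m'.2) ∧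
    (k < m'.2 → m'.1.cell d i' j' (k + 1) = m.1.cell d i j (min k m.2) → k < m.2)

theorem Compatible.symm {d : Dir} {m m' : Block L × ℕ} (h : Compatible G d m m') :
    Compatible G d m' m := by
  intro i hi j hj i' hi' j' hj' k
  obtain ⟨h1, h2, h3⟩ := h i' hi' j' hj' i hi j hj k
  exact ⟨fun ha hb => (h1 ha.symm ⟨hb.2, hb.1⟩).symm, h3, h2⟩

/-- The regions swept by two moving blocks have distance at least two in some coordinate. -/
def Apart (m m' : Block L × ℕ) : Dir → Prop
  | .N => m.1.x + m.1.w + 1 ≤ m'.1.x ∨ m'.1.x + m'.1.w + 1 ≤ m.1.x ∨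
      m.1.y + m.1.h + m.2 + 1 ≤ m'.1.y ∨ m'.1.y + m'.1.h + m'.2 + 1 ≤ m.1.y
  | .E => m.1.x + m.1.w + m.2 + 1 ≤ m'.1.x ∨ m'.1.x + m'.1.w + m'.2 + 1 ≤ m.1.x ∨
      m.1.y + m.1.h + 1 ≤ m'.1.y ∨ m'.1.y + m'.1.h + 1 ≤ m.1.y
  | .S => m.1.x + m.1.w + 1 ≤ m'.1.x ∨ m'.1.x + m'.1.w + 1 ≤ m.1.x ∨
      m.1.y + m.1.h + 1 ≤ m'.1.y - m'.2 ∨ m'.1.y + m'.1.h + 1 ≤ m.1.y - m.2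
  | .W => m.1.x + m.1.w + 1 ≤ m'.1.x - m'.2 ∨ m'.1.x + m'.1.w + 1 ≤ m.1.x - m.2 ∨
      m.1.y + m.1.h + 1 ≤ m'.1.y ∨ m'.1.y + m'.1.h + 1 ≤ m.1.y

/-- The times `k` and `k'` are independent because one block may have stopped while the other still
moves. A coordinate gap above one rules out collision and adjacency alike. -/
theorem Apart.coord {d : Dir} {m m' : Block L × ℕ} (h : Apart m m' d)
    {i j i' j' k k' : ℕ} (hi : i < m.1.w) (hj : j < m.1.h) (hi' : i' < m'.1.w)
    (hj' : j' < m'.1.h) (hk : k ≤ m.2) (hk' : k' ≤ m'.2) :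
    (m.1.cell d i j k).1 + 1 < (m'.1.cell d i' j' k').1 ∨
    (m'.1.cell d i' j' k').1 + 1 < (m.1.cell d i j k).1 ∨
    (m.1.cell d i j k).2 + 1 < (m'.1.cell d i' j' k').2 ∨
    (m'.1.cell d i' j' k').2 + 1 < (m.1.cell d i j k).2 := by
  cases d <;> simp only [Apart, cell, Dir.vec] at * <;> omega

theorem compatible_of_apart {d : Dir} {m m' : Block L × ℕ} (h : Apart m m' d) :
    Compatible G d m m' := by
  intro i hi j hj i' hi' j' hj' k
  refine ⟨fun ha _ => ?_, fun hk e => ?_, fun hk e => ?_⟩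
  · have := h.coord hi hj hi' hj' (min_le_right k _) (min_le_right k _)
    rw [grid_adj_iff] at ha
    omega
  · have := h.coord hi hj hi' hj' (Nat.succ_le_of_lt hk) (min_le_right k _)
    rw [Nat.succ_eq_add_one, e] at this
    omega
  · have := h.coord hi hj hi' hj' (min_le_right k _) (Nat.succ_le_of_lt hk)
    rw [Nat.succ_eq_add_one, e] at this
    omega

end Block

open Block

variable {L : Type} {G : L → L → Bool}

/-- The tiles of a list of blocks. -/
def blockTiles (bs : List (Block L)) : Set (Tile L) := {t | ∃ b ∈ bs, t ∈ b.tiles}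

namespace Configuration

/-- A tilt moves a list of compatible blocks rigidly, provided that the leading side of every block
ends at blocked locations or at tiles of other blocks that stopped earlier. -/
theorem exists_tilt_blocks_filter (C : Configuration G) (d : Dir) (ms : List (Block L × ℕ))
    (htiles : C.tiles = blockTiles (ms.map Prod.fst))
    (hfree : ∀ m ∈ ms, ∀ i < m.1.w, ∀ j < m.1.h, ∀ k < m.2,
      m.1.cell d i j (k + 1) ∉ C.board.blocked)
    (hpair : ms.Pairwise (Compatible G d))
    (hin : ∀ m ∈ ms, (m.1.w = 1 ∧ m.1.h = 1) ∨
      ∀ i < m.1.w, ∀ j < m.1.h, m.1.cell d i j m.2 ∈ C.board.locations)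
    (hrest : ∀ m ∈ ms, ∀ i < m.1.w, ∀ j < m.1.h, m.1.Front i j d →
      m.1.cell d i j m.2 ∈ C.board.locations → m.1.cell d i j (m.2 + 1) ∈ C.board.blocked ∨
        ∃ m' ∈ ms, m'.2 ≤ m.2 ∧ ∃ i' < m'.1.w, ∃ j' < m'.1.h,
          m'.1.cell d i' j' m'.2 = m.1.cell d i j (m.2 + 1) ∧
          m'.1.cell d i' j' m'.2 ∈ C.board.locations) :
    ∃ C', Tilt d C C' ∧ C'.board = C.board ∧
      C'.tiles = blockTiles (ms.map fun m => m.1.shift d m.2) ∩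
        {t | t.1 ∈ C.board.locations} := by
  -- One index per tile; every tile inherits the displacement of its block.
  let ι := {z : (Block L × ℕ) × ℕ × ℕ // z.1 ∈ ms ∧ z.2.1 < z.1.1.w ∧ z.2.2 < z.1.1.h}
  let p : ι → Cell := fun z => (z.1.1.1.x + z.1.2.1, z.1.1.1.y + z.1.2.2)
  let l : ι → L := fun z => z.1.1.1.lab z.1.2.1 z.1.2.2
  let n : ι → ℕ := fun z => z.1.1.2
  have hp : ∀ (z : ι) (k : ℕ), p z + k • d.vec = z.1.1.1.cell d z.1.2.1 z.1.2.2 k := by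
    intro z k
    ext <;> simp [p, cell]
  have : Std.Symm (Compatible G d) := ⟨fun _ _ h => h.symm⟩
  have hcompat : ∀ z z' : ι, z.1.1 ≠ z'.1.1 → Compatible G d z.1.1 z'.1.1 := by
    intro z z' hne
    exact hpair.forall z.2.1 z'.2.1 hne
  suffices h : ∃ C', Tilt d C C' ∧ C'.board = C.board ∧
      C'.tiles = {t | ∃ z, t = (p z + n z • d.vec, l z) ∧ t.1 ∈ C.board.locations} by
    obtain ⟨C', h1, h2, h3⟩ := h
    refine ⟨C', h1, h2, h3.trans ?_⟩
    ext t
    simp only [hp]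
    constructor
    · rintro ⟨⟨⟨m, i, j⟩, hm, hi, hj⟩, rfl, hl⟩
      refine ⟨⟨_, List.mem_map_of_mem hm, i, j, hi, hj, ?_⟩, hl⟩
      simp only [cell, shift, n, l]
      congr 2 <;> ring
    · rintro ⟨⟨b, hb, i, j, hi, hj, rfl⟩, hl⟩
      obtain ⟨m, hm, rfl⟩ := List.mem_map.1 hb
      refine ⟨⟨⟨m, i, j⟩, hm, hi, hj⟩, ?_, hl⟩
      simp only [cell, shift, n, l]
      congr 2 <;> ring
  refine exists_tilt_of_displacement C ((ms.map Prod.snd).sum) (fun z =>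
    List.single_le_sum (by simp) _ (List.mem_map_of_mem z.2.1)) ?_ ?_ ?_ ?_ ?_
  · rw [htiles]
    ext t
    constructor
    · rintro ⟨b, hb, i, j, hi, hj, rfl⟩
      obtain ⟨m, hm, rfl⟩ := List.mem_map.1 hb
      exact ⟨⟨⟨m, i, j⟩, hm, hi, hj⟩, rfl⟩
    · rintro ⟨⟨⟨m, i, j⟩, hm, hi, hj⟩, rfl⟩
      exact ⟨_, List.mem_map_of_mem hm, i, j, hi, hj, rfl⟩
  · intro z k hk
    rw [hp]
    exact hfree _ z.2.1 _ z.2.2.1 _ z.2.2.2 k hk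
  · intro z z' k hk he
    rw [hp, hp] at he
    by_cases hz : z.1.1 = z'.1.1
    · simpa only [n, ← hz] using hk
    · exact (hcompat z z' hz _ z.2.2.1 _ z.2.2.2 _ z'.2.2.1 _ z'.2.2.2 k).2.1 hk he
  · intro z z' k hl hl' ha hb
    rw [hp] at hl hl'
    rw [hp, hp] at ha
    rw [hp, hp]
    by_cases hz : z.1.1 = z'.1.1
    · refine ⟨fun h => by simpa only [n, ← hz] using h, fun hl1 => ?_⟩
      -- Only a single tile may leave the board, and it has no neighbour within its own block.
      rcases hin _ z.2.1 with ⟨hw, hh⟩ | hs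
      · exfalso
        have e1 := z.2.2.1
        have e2 := z.2.2.2
        have e3 := z'.2.2.1
        have e4 := z'.2.2.2
        rw [← hz] at e3 e4
        have e5 : z'.1.2.1 = z.1.2.1 := by omega
        have e6 : z'.1.2.2 = z.1.2.2 := by omega
        simp only [n, ← hz, e5, e6] at ha
        exact grid.irrefl ha
      · have := hs _ (hz ▸ z'.2.2.1) _ (hz ▸ z'.2.2.2)
        rw [hz] at this
        have h0 := (C.mem_open (p z', l z') ?_).1
        · rw [← hp] at this ⊢
          exact add_smul_mem_locations d (min_le_right _ _) h0 this
        · rw [htiles]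
          exact ⟨_, List.mem_map_of_mem z'.2.1, _, _, z'.2.2.1, z'.2.2.2, rfl⟩
    · have := (hcompat z z' hz _ z.2.2.1 _ z.2.2.2 _ z'.2.2.1 _ z'.2.2.2 k).1 ha hb
      refine ⟨fun h => absurd this.1 (by simpa [n] using h), fun _ => ?_⟩
      have h2 : n z' ≤ k := this.2
      rwa [min_eq_right (by omega), ← min_eq_right h2]
  · intro z hl
    rw [hp] at hl
    by_cases hf : z.1.1.1.Front z.1.2.1 z.1.2.2 d
    · rcases hrest _ z.2.1 _ z.2.2.1 _ z.2.2.2 hf hl with h | ⟨m', hm', hle, i', hi', j', hj', he⟩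
      · left
        rwa [hp]
      · right
        refine ⟨⟨⟨m', i', j'⟩, hm', hi', hj'⟩, hle, ?_⟩
        rw [hp, hp]
        exact he
    -- A tile behind the front is supported by the next tile of its own block, which has the same
    -- displacement.
    · right
      rcases hin _ z.2.1 with ⟨hw, hh⟩ | hs
      · exfalso
        have e1 := z.2.2.1
        have e2 := z.2.2.2
        cases d <;> simp only [Front] at hf <;> omega
      obtain ⟨⟨m, i, j⟩, hm, hi, hj⟩ := z
      simp only at hi hj
      have hex : ∃ i' < m.1.w, ∃ j' < m.1.h, m.1.cell d i' j' m.2 = m.1.cell d i j (m.2 + 1) := by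
        cases d <;> simp only [Front] at hf
        · exact ⟨i, hi, j + 1, by omega, by simp [cell, Dir.vec]; ring⟩
        · exact ⟨i + 1, by omega, j, hj, by simp [cell, Dir.vec]; ring⟩
        · exact ⟨i, hi, j - 1, by omega, by
            simp only [cell, Dir.vec]; congr 1; push_cast; omega⟩
        · exact ⟨i - 1, by omega, j, hj, by
            simp only [cell, Dir.vec]; congr 1; push_cast; omega⟩
      obtain ⟨i', hi', j', hj', he⟩ := hex
      refine ⟨⟨⟨m, i', j'⟩, hm, hi', hj'⟩, le_rfl, ?_⟩
      rw [hp, hp]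
      exact ⟨he, hs _ hi' _ hj'⟩

theorem TiltSequence.append {C C' C'' : Configuration G} {D' : List Dir} :
    ∀ {D : List Dir}, TiltSequence D C C' → TiltSequence D' C' C'' → TiltSequence (D ++ D') C C''
  | [], h, h' => by
    have h : C = C' := h
    rwa [h]
  | _ :: _, ⟨C₁, h₁, h⟩, h' => ⟨C₁, h₁, TiltSequence.append h h'⟩

end Configuration

open TiltAssembly.Configuration

/-- The block stays on open locations while it moves. -/
def Block.Glides (B : Board) (d : Dir) (m : Block L × ℕ) : Prop :=
  ∀ i < m.1.w, ∀ j < m.1.h, ∀ k ≤ m.2, m.1.cell d i j k ∈ B.openCells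

/-- The leading side of the block is stopped by blocked locations. -/
def Block.Lands (B : Board) (d : Dir) (m : Block L × ℕ) : Prop :=
  ∀ i < m.1.w, ∀ j < m.1.h, m.1.Front i j d → m.1.cell d i j (m.2 + 1) ∈ B.blocked

/-- On the board `B`, the tilt sequence `D` turns the blocks `bs` into the blocks `bs'`. -/
def Moves (G : L → L → Bool) (B : Board) (D : List Dir) (bs bs' : List (Block L)) : Prop :=
  ∀ C : Configuration G, C.board = B → C.tiles = blockTiles bs →
    ∃ C', TiltSequence D C C' ∧ C'.board = B ∧ C'.tiles = blockTiles bs'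

namespace Moves

variable {B : Board} {D D' : List Dir} {bs bs' bs'' : List (Block L)} {d : Dir}

theorem refl : Moves G B [] bs bs := fun C hB hC => ⟨C, rfl, hB, hC⟩

theorem trans (h : Moves G B D bs bs') (h' : Moves G B D' bs' bs'') :
    Moves G B (D ++ D') bs bs'' := by
  intro C hB hC
  obtain ⟨C₁, h1, hB1, hC1⟩ := h C hB hC
  obtain ⟨C₂, h2, hB2, hC2⟩ := h' C₁ hB1 hC1
  exact ⟨C₂, h1.append h2, hB2, hC2⟩

/-- Only the set of tiles matters, so the same tiles can be cut into different blocks before the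
next tilt. -/
theorem congr_left (h : Moves G B D bs bs') (e : blockTiles bs'' = blockTiles bs) :
    Moves G B D bs'' bs' := fun C hB hC => h C hB (hC.trans e)

theorem congr_right (h : Moves G B D bs bs') (e : blockTiles bs' = blockTiles bs'') :
    Moves G B D bs bs'' := fun C hB hC => by
  obtain ⟨C₁, h1, hB1, hC1⟩ := h C hB hC
  exact ⟨C₁, h1, hB1, hC1.trans e⟩

theorem of_glides (ms : List (Block L × ℕ)) (hglide : ∀ m ∈ ms, m.1.w = 1 ∧ m.1.h = 1 ∧
      (∀ k < m.2, m.1.cell d 0 0 (k + 1) ∉ B.blocked) ∧ m.1.cell d 0 0 m.2 ∉ B.locations ∨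
      Glides B d m)
    (hpair : ms.Pairwise (Compatible G d))
    (hrest : ∀ m ∈ ms, Lands B d m ∨ m.1.cell d 0 0 m.2 ∉ B.locations ∧ m.1.w = 1 ∧ m.1.h = 1 ∨
      ∃ m' ∈ ms, m'.2 ≤ m.2 ∧ Glides B d m' ∧ ∀ i < m.1.w, ∀ j < m.1.h, m.1.Front i j d →
        ∃ i' < m'.1.w, ∃ j' < m'.1.h, m'.1.cell d i' j' m'.2 = m.1.cell d i j (m.2 + 1)) :
    ∀ C : Configuration G, C.board = B → C.tiles = blockTiles (ms.map Prod.fst) →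
    ∃ C', TiltSequence [d] C C' ∧ C'.board = B ∧
      C'.tiles = blockTiles (ms.map fun m => m.1.shift d m.2) ∩ {t | t.1 ∈ B.locations} := by
  rintro C rfl hC
  refine (exists_tilt_blocks_filter C d ms hC ?_ hpair ?_ ?_).imp fun C' ⟨h1, h2, h3⟩ =>
    ⟨⟨C', h1, rfl⟩, h2, h3⟩
  · intro m hm i hi j hj k hk
    rcases hglide m hm with ⟨hw, hh, h, -⟩ | h
    · obtain rfl : i = 0 := by omega
      obtain rfl : j = 0 := by omega
      exact h k hk
    · exact (h i hi j hj (k + 1) hk).2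
  · intro m hm
    rcases hglide m hm with ⟨hw, hh, -⟩ | h
    · exact Or.inl ⟨hw, hh⟩
    · exact Or.inr fun i hi j hj => (h i hi j hj _ le_rfl).1
  · intro m hm i hi j hj hf hl
    rcases hrest m hm with h | ⟨h, hw, hh⟩ | ⟨m', hm', hle, hg, h⟩
    · exact Or.inl (h i hi j hj hf)
    · obtain rfl : i = 0 := by omega
      obtain rfl : j = 0 := by omega
      exact absurd hl h
    · obtain ⟨i', hi', j', hj', he⟩ := h i hi j hj hf
      exact Or.inr ⟨m', hm', hle, i', hi', j', hj', he, (hg i' hi' j' hj' _ le_rfl).1⟩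

theorem of_lands_or_contact (ms : List (Block L × ℕ)) (hbs : bs = ms.map Prod.fst)
    (hbs' : (ms.map fun m => m.1.shift d m.2) = bs') (hglide : ∀ m ∈ ms, Glides B d m)
    (hpair : ms.Pairwise (Compatible G d))
    (hrest : ∀ m ∈ ms, Lands B d m ∨ ∃ m' ∈ ms, m'.2 ≤ m.2 ∧
      ∀ i < m.1.w, ∀ j < m.1.h, m.1.Front i j d →
        ∃ i' < m'.1.w, ∃ j' < m'.1.h, m'.1.cell d i' j' m'.2 = m.1.cell d i j (m.2 + 1)) :
    Moves G B [d] bs bs' := by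
  subst hbs hbs'
  intro C hB hC
  obtain ⟨C', h1, h2, h3⟩ := of_glides ms (fun m hm => Or.inr (hglide m hm)) hpair (fun m hm =>
    (hrest m hm).imp_right fun ⟨m', hm', hle, h⟩ => Or.inr ⟨m', hm', hle, hglide m' hm', h⟩) C hB hC
  refine ⟨C', h1, h2, h3.trans (Set.inter_eq_left.2 ?_)⟩
  rintro t ⟨b, hb, i, j, hi, hj, rfl⟩
  obtain ⟨m, hm, rfl⟩ := List.mem_map.1 hb
  have := (hglide m hm i hi j hj _ le_rfl).1
  simp only [cell] at this
  simp only [shift, Set.mem_ofPred_eq]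
  convert this using 2 <;> ring

theorem of_lands (ms : List (Block L × ℕ)) (hbs : bs = ms.map Prod.fst)
    (hbs' : (ms.map fun m => m.1.shift d m.2) = bs') (hglide : ∀ m ∈ ms, Glides B d m ∧ Lands B d m)
    (hpair : ms.Pairwise (Compatible G d)) :
    Moves G B [d] bs bs' :=
  of_lands_or_contact ms hbs hbs'
    (fun m hm => (hglide m hm).1) hpair fun m hm => Or.inl (hglide m hm).2

end Moves

end TiltAssembly

/-! ### The machine: geometry and the handling of one queue tile. -/

namespace TiltAssembly

open TiltAssembly.Configuration Block

/-- The open region of the machine. -/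
def MachineOpen (W K : ℕ) (p : Cell) : Prop :=
  -- the exit corridor
  (1 ≤ p.1 ∧ p.1 ≤ 3 ∧ p.2 = K + 3) ∨
  -- the queue
  (2 ≤ p.1 ∧ p.1 ≤ 2 * W + 2 ∧ p.2 = K + 5) ∨
  -- the hole below the queue
  (p.1 = 2 ∧ p.2 = K + 4) ∨
  -- the landing shaft above the queue
  (3 ≤ p.1 ∧ p.1 ≤ 2 * W + 2 ∧ K + 5 ≤ p.2 ∧ p.2 ≤ 2 * K + 6) ∨
  -- the supply corridor
  (3 ≤ p.1 ∧ p.1 ≤ 5 * W + 4 ∧ p.2 = 2 * K + 6) ∨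
  -- the reservoir
  (3 * W + 5 ≤ p.1 ∧ p.1 ≤ 5 * W + 4 ∧ 6 ≤ p.2 ∧ p.2 ≤ 2 * K + 6) ∨
  -- the slot in which a row is collected
  (3 ≤ p.1 ∧ p.1 ≤ W + 3 ∧ p.2 = K + 1) ∨
  -- the delivery corridor
  (3 ≤ p.1 ∧ p.1 ≤ 3 * W + 3 ∧ p.2 = K + 2) ∨
  -- the assembly chamber
  (2 * W + 4 ≤ p.1 ∧ p.1 ≤ 3 * W + 3 ∧ 2 ≤ p.2 ∧ p.2 ≤ 2 * K + 2)

/-- The board of the machine that assembles `K` rows of length `W`. -/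
def machine (W K : ℕ) : Board where
  m := 5 * W + 5
  n := 2 * K + 7
  blocked := {p | p ∈ Set.Icc 1 ((5 * W + 5 : ℕ) : ℤ) ×ˢ Set.Icc 1 ((2 * K + 7 : ℕ) : ℤ) ∧
    ¬ MachineOpen W K p}
  blocked_subset := fun _ h => h.1

section Machine

variable {W K : ℕ}

theorem mem_machine_locations {p : Cell} : p ∈ (machine W K).locations ↔
    (1 ≤ p.1 ∧ p.1 ≤ 5 * W + 5) ∧ 1 ≤ p.2 ∧ p.2 ≤ 2 * K + 7 := by
  simp only [Board.locations, machine, Set.mem_prod, Set.mem_Icc]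
  push_cast
  rfl

theorem mem_machine_blocked {p : Cell} : p ∈ (machine W K).blocked ↔
    ((1 ≤ p.1 ∧ p.1 ≤ 5 * W + 5) ∧ 1 ≤ p.2 ∧ p.2 ≤ 2 * K + 7) ∧ ¬ MachineOpen W K p := by
  simp only [machine, Set.mem_ofPred_eq, Set.mem_prod, Set.mem_Icc]
  push_cast
  rfl

theorem mem_machine_openCells (hW : 0 < W) {p : Cell} (h : MachineOpen W K p) :
    p ∈ (machine W K).openCells := by
  refine ⟨mem_machine_locations.2 ?_, fun hb => (mem_machine_blocked.1 hb).2 h⟩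
  unfold MachineOpen at h
  omega

/-- The label of the tile `(i, j)` of the reservoir: sticky tiles alternate with sand in the even
rows, the odd rows consist of sand. -/
def supply (i j : ℕ) : Bool := decide (i % 2 = 1 ∧ j % 2 = 0)

/-- The last `q` tiles of row `r` of the reservoir. -/
def queueBlock (W q r : ℕ) (x y : ℤ) : Block Bool := ⟨x, y, q, 1,
  fun i _ => supply (2 * W - q + i) r⟩

/-- The last `j` tiles of row `r` of the target. -/
def slotBlock (F : ℕ → ℕ → Bool) (W j r : ℕ) (x y : ℤ) : Block Bool :=
  ⟨x, y, j, 1, fun i _ => F (W - j + i) r⟩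

/-- The last `k` rows of the target. -/
def assemblyBlock (F : ℕ → ℕ → Bool) (W K k : ℕ) (x y : ℤ) : Block Bool :=
  ⟨x, y, W, k, fun i j => F i (K - k + j)⟩

/-- The first `r` rows of the reservoir. -/
def reservoirBlock (W r : ℕ) (x y : ℤ) : Block Bool := ⟨x, y, 2 * W, r, supply⟩

def tileBlock (a : Bool) (x y : ℤ) : Block Bool := ⟨x, y, 1, 1, fun _ _ => a⟩

/-- The state with `q` tiles of row `r` in the queue and `j` tiles of the current row in the slot,
`k` rows assembled and `r` rows in the reservoir. -/
def machineState (F : ℕ → ℕ → Bool) (W K q r j k : ℕ) : List (Block Bool) :=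
  [queueBlock W q r (2 * W + 3 - q) (K + 5), slotBlock F W j (K - k - 1) (W + 4 - j) (K + 1),
    assemblyBlock F W K k (2 * W + 4) 2, reservoirBlock W r (3 * W + 5) 6]

theorem supply_eq_false_of_succ (i j : ℕ) : supply i j = false ∨ supply (i + 1) j = false := by
  simp only [supply, decide_eq_false_iff_not]; omega

variable {F : ℕ → ℕ → Bool} {q r j k : ℕ}

/-- At most `K` rows resting on the floor of the chamber stay below the delivery corridor at height
`K + 2`, its only side opening. -/
theorem assembly_static {d : Dir} (hd : d ≠ .N) (hW : 0 < W) (hk : k ≤ K) :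
    Glides (machine W K) d (assemblyBlock F W K k (2 * W + 4) 2, 0) ∧
    Lands (machine W K) d (assemblyBlock F W K k (2 * W + 4) 2, 0) := by
  constructor
  · intro i hi j hj l hl
    refine mem_machine_openCells hW ?_
    iterate 8 refine Or.inr ?_
    cases d
    · exact absurd rfl hd
    all_goals
      simp only [assemblyBlock, cell, Dir.vec] at *
      omega
  · intro i hi j hj hf
    rw [mem_machine_blocked]
    unfold MachineOpen
    cases d
    · exact absurd rfl hd
    all_goals
      simp only [assemblyBlock, cell, Dir.vec, Front] at *
      omega

/-- At most `2 * K` rows resting at height `6` end just below the supply corridor at height `2 * K +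
6`. -/
theorem reservoir_static {d : Dir} (hd : d ≠ .N) (hW : 0 < W) (hr : r ≤ 2 * K) :
    Glides (machine W K) d (reservoirBlock W r (3 * W + 5) 6, 0) ∧
    Lands (machine W K) d (reservoirBlock W r (3 * W + 5) 6, 0) := by
  constructor
  · intro i hi j hj l hl
    refine mem_machine_openCells hW ?_
    iterate 5 refine Or.inr ?_
    refine Or.inl ?_
    cases d
    · exact absurd rfl hd
    all_goals
      simp only [reservoirBlock, cell, Dir.vec] at *
      omega
  · intro i hi j hj hf
    rw [mem_machine_blocked]
    unfold MachineOpen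
    cases d
    · exact absurd rfl hd
    all_goals
      simp only [reservoirBlock, cell, Dir.vec, Front] at *
      omega

theorem queue_west {x : ℤ} {n : ℕ} (hx : x = n + 2) (hn : x + q ≤ 2 * W + 3) (hW : 0 < W) :
    Glides (machine W K) .W (queueBlock W q r x (K + 5), n) ∧
    Lands (machine W K) .W (queueBlock W q r x (K + 5), n) := by
  constructor
  · intro i hi j hj l hl
    refine mem_machine_openCells hW ?_
    iterate 1 refine Or.inr ?_
    refine Or.inl ?_
    simp only [queueBlock, cell, Dir.vec] at *
    omega
  · intro i hi j hj hf
    rw [mem_machine_blocked]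
    unfold MachineOpen
    simp only [queueBlock, cell, Dir.vec, Front] at *
    omega

theorem slot_west {x : ℤ} {n t : ℕ} (hx : x = n + 3) (hn : x + j ≤ W + 4) (hW : 0 < W) :
    Glides (machine W K) .W (slotBlock F W j t x (K + 1), n) ∧
    Lands (machine W K) .W (slotBlock F W j t x (K + 1), n) := by
  constructor
  · intro i hi j hj l hl
    refine mem_machine_openCells hW ?_
    iterate 6 refine Or.inr ?_
    refine Or.inl ?_
    simp only [slotBlock, cell, Dir.vec] at *
    omega
  · intro i hi j hj hf
    rw [mem_machine_blocked]
    unfold MachineOpen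
    simp only [slotBlock, cell, Dir.vec, Front] at *
    omega

theorem moves_west (hW : 0 < W) (hq : q ≤ 2 * W) (hj : j ≤ W) (hk : k ≤ K) (hr : r ≤ 2 * K) :
    Moves (· && ·) (machine W K) [.W] (machineState F W K q r j k)
      [queueBlock W q r 2 (K + 5), slotBlock F W j (K - k - 1) 3 (K + 1),
        assemblyBlock F W K k (2 * W + 4) 2, reservoirBlock W r (3 * W + 5) 6] := by
  refine Moves.of_lands
    [(queueBlock W q r (2 * W + 3 - q) (K + 5), 2 * W + 1 - q),
      (slotBlock F W j (K - k - 1) (W + 4 - j) (K + 1), W + 1 - j),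
      (assemblyBlock F W K k (2 * W + 4) 2, 0), (reservoirBlock W r (3 * W + 5) 6, 0)] rfl ?_ ?_ ?_
  · simp only [List.map_cons, List.map_nil, queueBlock, slotBlock, assemblyBlock, reservoirBlock,
      shift, Dir.vec, List.cons.injEq, Block.mk.injEq, and_true]
    omega
  · simp only [List.forall_mem_cons]
    refine ⟨queue_west (by omega) (by omega) hW, slot_west (by omega) (by omega) hW,
      assembly_static (by simp) hW hk, reservoir_static (by simp) hW hr, by simp⟩
  · simp only [List.pairwise_cons, List.forall_mem_cons]
    refine ⟨⟨?_, ?_, ?_, by simp⟩, ⟨?_, ?_, by simp⟩, ⟨?_, by simp⟩, by simp⟩ <;>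
    · refine compatible_of_apart ?_
      simp only [queueBlock, slotBlock, assemblyBlock, reservoirBlock, Apart]
      omega

theorem queue_east {x : ℤ} {n : ℕ} (hx : 2 ≤ x) (hn : x + q + n = 2 * W + 3) (hW : 0 < W) :
    Glides (machine W K) .E (queueBlock W q r x (K + 5), n) ∧
    Lands (machine W K) .E (queueBlock W q r x (K + 5), n) := by
  constructor
  · intro i hi j hj l hl
    refine mem_machine_openCells hW ?_
    iterate 1 refine Or.inr ?_
    refine Or.inl ?_
    simp only [queueBlock, cell, Dir.vec] at *
    omega
  · intro i hi j hj hf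
    rw [mem_machine_blocked]
    unfold MachineOpen
    simp only [queueBlock, cell, Dir.vec, Front] at *
    omega

theorem slot_east {x : ℤ} {n t : ℕ} (hx : 3 ≤ x) (hn : x + j + n = W + 4) (hW : 0 < W) :
    Glides (machine W K) .E (slotBlock F W j t x (K + 1), n) ∧
    Lands (machine W K) .E (slotBlock F W j t x (K + 1), n) := by
  constructor
  · intro i hi j hj l hl
    refine mem_machine_openCells hW ?_
    iterate 6 refine Or.inr ?_
    refine Or.inl ?_
    simp only [slotBlock, cell, Dir.vec] at *
    omega
  · intro i hi j hj hf
    rw [mem_machine_blocked]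
    unfold MachineOpen
    simp only [slotBlock, cell, Dir.vec, Front] at *
    omega

theorem queue_south {x : ℤ} (hx : 3 ≤ x) (hn : x + q ≤ 2 * W + 3) (hW : 0 < W) :
    Glides (machine W K) .S (queueBlock W q r x (K + 5), 0) ∧
    Lands (machine W K) .S (queueBlock W q r x (K + 5), 0) := by
  constructor
  · intro i hi j hj l hl
    refine mem_machine_openCells hW ?_
    iterate 1 refine Or.inr ?_
    refine Or.inl ?_
    simp only [queueBlock, cell, Dir.vec] at *
    omega
  · intro i hi j hj hf
    rw [mem_machine_blocked]
    unfold MachineOpen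
    simp only [queueBlock, cell, Dir.vec, Front] at *
    omega

/-- The floor of the slot has height `K`; `0 < K` ensures that it consists of blocked locations of
the board. -/
theorem slot_south {x : ℤ} {t : ℕ} (hx : 3 ≤ x) (hn : x + j ≤ W + 4) (hK : 0 < K) (hW : 0 < W) :
    Glides (machine W K) .S (slotBlock F W j t x (K + 1), 0) ∧
    Lands (machine W K) .S (slotBlock F W j t x (K + 1), 0) := by
  constructor
  · intro i hi j hj l hl
    refine mem_machine_openCells hW ?_
    iterate 6 refine Or.inr ?_
    refine Or.inl ?_
    simp only [slotBlock, cell, Dir.vec] at *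
    omega
  · intro i hi j hj hf
    rw [mem_machine_blocked]
    unfold MachineOpen
    simp only [slotBlock, cell, Dir.vec, Front] at *
    omega

/-- The fall ends in the exit corridor because the delivery corridor below starts only at `x = 3`.
-/
theorem tile_release_south {a : Bool} (hW : 0 < W) :
    Glides (machine W K) .S (tileBlock a 2 (K + 5), 2) ∧
    Lands (machine W K) .S (tileBlock a 2 (K + 5), 2) := by
  constructor
  · intro i hi j hj l hl
    refine mem_machine_openCells hW ?_
    unfold MachineOpen
    simp only [tileBlock, cell, Dir.vec] at *
    interval_cases l <;> omega
  · intro i hi j hj hf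
    rw [mem_machine_blocked]
    unfold MachineOpen
    simp only [tileBlock, cell, Dir.vec, Front] at *
    omega

theorem tile_accept_east {a : Bool} (hW : 0 < W) :
    Glides (machine W K) .E (tileBlock a 2 (K + 3), 1) ∧
    Lands (machine W K) .E (tileBlock a 2 (K + 3), 1) := by
  constructor
  · intro i hi j hj l hl
    refine mem_machine_openCells hW ?_
    unfold MachineOpen
    simp only [tileBlock, cell, Dir.vec] at *
    interval_cases l <;> omega
  · intro i hi j hj hf
    rw [mem_machine_blocked]
    unfold MachineOpen
    simp only [tileBlock, cell, Dir.vec, Front] at *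
    omega

theorem tile_accept_south {a : Bool} (hK : 0 < K) (hW : 0 < W) :
    Glides (machine W K) .S (tileBlock a 3 (K + 3), 2) ∧
    Lands (machine W K) .S (tileBlock a 3 (K + 3), 2) := by
  constructor
  · intro i hi j hj l hl
    refine mem_machine_openCells hW ?_
    unfold MachineOpen
    simp only [tileBlock, cell, Dir.vec] at *
    interval_cases l <;> omega
  · intro i hi j hj hf
    rw [mem_machine_blocked]
    unfold MachineOpen
    simp only [tileBlock, cell, Dir.vec, Front] at *
    omega

/-- The dropped tile touches only the new first tile of the queue, and only before it starts to
fall; one of the two is sand. -/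
theorem compatible_release {a : Bool} (ha : a = false ∨ supply (2 * W - q) r = false) :
    Compatible (· && ·) .S (tileBlock a 2 (K + 5), 2) (queueBlock W q r 3 (K + 5), 0) := by
  intro i hi j' hj' i' hi' j'' hj'' l
  simp only [tileBlock, queueBlock, cell, Dir.vec, grid_adj_iff, Prod.mk.injEq] at *
  refine ⟨fun h hatt => ?_, by omega, by omega⟩
  obtain rfl : i' = 0 := by omega
  rcases ha with ha | ha <;> simp [Attract, ha] at hatt

theorem moves_release {a : Bool} (hK : 0 < K) (hW : 0 < W) (hq : q < 2 * W) (hj : j ≤ W)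
    (hk : k ≤ K)
    (hr : r ≤ 2 * K) (ha : a = false ∨ supply (2 * W - q) r = false) :
    Moves (· && ·) (machine W K) [.S]
      [tileBlock a 2 (K + 5),
        queueBlock W q r 3 (K + 5),
        slotBlock F W j (K - k - 1) 3 (K + 1),
        assemblyBlock F W K k (2 * W + 4) 2,
        reservoirBlock W r (3 * W + 5) 6]
      [tileBlock a 2 (K + 3),
        queueBlock W q r 3 (K + 5),
        slotBlock F W j (K - k - 1) 3 (K + 1),
        assemblyBlock F W K k (2 * W + 4) 2,
        reservoirBlock W r (3 * W + 5) 6] := by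
  refine Moves.of_lands
    [(tileBlock a 2 (K + 5), 2),
      (queueBlock W q r 3 (K + 5), 0),
      (slotBlock F W j (K - k - 1) 3 (K + 1), 0),
      (assemblyBlock F W K k (2 * W + 4) 2, 0),
      (reservoirBlock W r (3 * W + 5) 6, 0)] rfl ?_ ?_ ?_
  · simp only [List.map_cons, List.map_nil, tileBlock, queueBlock, slotBlock, assemblyBlock,
      reservoirBlock, shift, Dir.vec, List.cons.injEq, Block.mk.injEq, and_true]
    omega
  · simp only [List.forall_mem_cons]
    exact ⟨tile_release_south hW, queue_south (by omega) (by omega) hW,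
      slot_south (by omega) (by omega) hK hW, assembly_static (by simp) hW hk,
      reservoir_static (by simp) hW hr, by simp⟩
  · simp only [List.pairwise_cons, List.forall_mem_cons]
    refine ⟨⟨?p01, ?_, ?_, ?_, by simp⟩, ⟨?_, ?_, ?_, by simp⟩, ⟨?_, ?_, by simp⟩, ⟨?_, by simp⟩,
      by simp, .nil⟩
    case p01 =>
      exact compatible_release ha
    all_goals
      refine compatible_of_apart ?_
      simp only [tileBlock, queueBlock, slotBlock, assemblyBlock, reservoirBlock, Apart]
      omega

theorem moves_accept_east {a : Bool} (hW : 0 < W) (hq : q < 2 * W) (hj : j ≤ W)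
    (hk : k ≤ K) (hr : r ≤ 2 * K) :
    Moves (· && ·) (machine W K) [.E]
      [tileBlock a 2 (K + 3),
        queueBlock W q r 3 (K + 5),
        slotBlock F W j (K - k - 1) 3 (K + 1),
        assemblyBlock F W K k (2 * W + 4) 2,
        reservoirBlock W r (3 * W + 5) 6]
      [tileBlock a 3 (K + 3),
        queueBlock W q r (2 * W + 3 - q) (K + 5),
        slotBlock F W j (K - k - 1) (W + 4 - j) (K + 1),
        assemblyBlock F W K k (2 * W + 4) 2,
        reservoirBlock W r (3 * W + 5) 6] := by
  refine Moves.of_lands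
    [(tileBlock a 2 (K + 3), 1),
      (queueBlock W q r 3 (K + 5), 2 * W - q),
      (slotBlock F W j (K - k - 1) 3 (K + 1), W + 1 - j),
      (assemblyBlock F W K k (2 * W + 4) 2, 0),
      (reservoirBlock W r (3 * W + 5) 6, 0)] rfl ?_ ?_ ?_
  · simp only [List.map_cons, List.map_nil, tileBlock, queueBlock, slotBlock, assemblyBlock,
      reservoirBlock, shift, Dir.vec, List.cons.injEq, Block.mk.injEq, and_true]
    omega
  · simp only [List.forall_mem_cons]
    exact ⟨tile_accept_east hW, queue_east (by omega) (by omega) hW,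
      slot_east (by omega) (by omega) hW, assembly_static (by simp) hW hk,
      reservoir_static (by simp) hW hr, by simp⟩
  · simp only [List.pairwise_cons, List.forall_mem_cons]
    refine ⟨⟨?_, ?_, ?_, ?_, by simp⟩, ⟨?_, ?_, ?_, by simp⟩, ⟨?_, ?_, by simp⟩, ⟨?_, by simp⟩,
      by simp, .nil⟩
    all_goals
      refine compatible_of_apart ?_
      simp only [tileBlock, queueBlock, slotBlock, assemblyBlock, reservoirBlock, Apart]
      omega

/-- The slot has `W + 1` places. With `j < W` its tiles, pushed to the east, start at `x ≥ 5`, so a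
tile falling at `x = 3` touches none of them. -/
theorem moves_accept_south {a : Bool} (hK : 0 < K) (hW : 0 < W) (hq : q < 2 * W) (hj : j < W)
    (hk : k ≤ K) (hr : r ≤ 2 * K) :
    Moves (· && ·) (machine W K) [.S]
      [tileBlock a 3 (K + 3),
        queueBlock W q r (2 * W + 3 - q) (K + 5),
        slotBlock F W j (K - k - 1) (W + 4 - j) (K + 1),
        assemblyBlock F W K k (2 * W + 4) 2,
        reservoirBlock W r (3 * W + 5) 6]
      [tileBlock a 3 (K + 1),
        queueBlock W q r (2 * W + 3 - q) (K + 5),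
        slotBlock F W j (K - k - 1) (W + 4 - j) (K + 1),
        assemblyBlock F W K k (2 * W + 4) 2,
        reservoirBlock W r (3 * W + 5) 6] := by
  refine Moves.of_lands
    [(tileBlock a 3 (K + 3), 2),
      (queueBlock W q r (2 * W + 3 - q) (K + 5), 0),
      (slotBlock F W j (K - k - 1) (W + 4 - j) (K + 1), 0),
      (assemblyBlock F W K k (2 * W + 4) 2, 0),
      (reservoirBlock W r (3 * W + 5) 6, 0)] rfl ?_ ?_ ?_
  · simp only [List.map_cons, List.map_nil, tileBlock, queueBlock, slotBlock, assemblyBlock,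
      reservoirBlock, shift, Dir.vec, List.cons.injEq, Block.mk.injEq, and_true]
    omega
  · simp only [List.forall_mem_cons]
    exact ⟨tile_accept_south hK hW, queue_south (by omega) (by omega) hW,
      slot_south (by omega) (by omega) hK hW, assembly_static (by simp) hW hk,
      reservoir_static (by simp) hW hr, by simp⟩
  · simp only [List.pairwise_cons, List.forall_mem_cons]
    refine ⟨⟨?_, ?_, ?_, ?_, by simp⟩, ⟨?_, ?_, ?_, by simp⟩, ⟨?_, ?_, by simp⟩, ⟨?_, by simp⟩,
      by simp, .nil⟩
    all_goals
      refine compatible_of_apart ?_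
      simp only [tileBlock, queueBlock, slotBlock, assemblyBlock, reservoirBlock, Apart]
      omega

theorem moves_discard_east (hW : 0 < W) (hq : q < 2 * W) (hj : j ≤ W)
    (hk : k ≤ K) (hr : r ≤ 2 * K) :
    Moves (· && ·) (machine W K) [.E]
      [queueBlock W q r 2 (K + 5),
        slotBlock F W j (K - k - 1) 3 (K + 1),
        assemblyBlock F W K k (2 * W + 4) 2,
        reservoirBlock W r (3 * W + 5) 6]
      [queueBlock W q r (2 * W + 3 - q) (K + 5),
        slotBlock F W j (K - k - 1) (W + 4 - j) (K + 1),
        assemblyBlock F W K k (2 * W + 4) 2,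
        reservoirBlock W r (3 * W + 5) 6] := by
  refine Moves.of_lands
    [(queueBlock W q r 2 (K + 5), 2 * W + 1 - q),
      (slotBlock F W j (K - k - 1) 3 (K + 1), W + 1 - j),
      (assemblyBlock F W K k (2 * W + 4) 2, 0),
      (reservoirBlock W r (3 * W + 5) 6, 0)] rfl ?_ ?_ ?_
  · simp only [List.map_cons, List.map_nil, queueBlock, slotBlock, assemblyBlock,
      reservoirBlock, shift, Dir.vec, List.cons.injEq, Block.mk.injEq, and_true]
    omega
  · simp only [List.forall_mem_cons]
    exact ⟨queue_east (by omega) (by omega) hW,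
      slot_east (by omega) (by omega) hW, assembly_static (by simp) hW hk,
      reservoir_static (by simp) hW hr, by simp⟩
  · simp only [List.pairwise_cons, List.forall_mem_cons]
    refine ⟨⟨?_, ?_, ?_, by simp⟩, ⟨?_, ?_, by simp⟩, ⟨?_, by simp⟩, by simp, .nil⟩
    all_goals
      refine compatible_of_apart ?_
      simp only [queueBlock, slotBlock, assemblyBlock, reservoirBlock, Apart]
      omega

/-- After `W - j` units the tile reaches its first contact with the slot tiles, exactly where it
stops, so any bond forms between resting tiles. -/
theorem compatible_tile_slot {a : Bool} {t : ℕ} :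
    Compatible (· && ·) .E (tileBlock a 3 (K + 1), W - j) (slotBlock F W j t (W + 4 - j) (K + 1),
      0) := by
  intro i hi j' hj' i' hi' j'' hj'' l
  simp only [tileBlock, slotBlock, cell, Dir.vec, grid_adj_iff, Prod.mk.injEq] at *
  omega

theorem tile_pack_east {a : Bool} (hW : 0 < W) (hj : j < W) :
    Glides (machine W K) .E (tileBlock a 3 (K + 1), W - j) := by
  intro i hi j' hj' l hl
  refine mem_machine_openCells hW ?_
  iterate 6 refine Or.inr ?_
  refine Or.inl ?_
  simp only [tileBlock, cell, Dir.vec] at *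
  omega

theorem moves_accept_pack {a : Bool} (hW : 0 < W) (hq : q < 2 * W) (hj : j < W)
    (hk : k ≤ K) (hr : r ≤ 2 * K) :
    Moves (· && ·) (machine W K) [.E]
      [tileBlock a 3 (K + 1), queueBlock W q r (2 * W + 3 - q) (K + 5),
        slotBlock F W j (K - k - 1) (W + 4 - j) (K + 1), assemblyBlock F W K k (2 * W + 4) 2,
        reservoirBlock W r (3 * W + 5) 6]
      [tileBlock a (W + 3 - j) (K + 1), queueBlock W q r (2 * W + 3 - q) (K + 5),
        slotBlock F W j (K - k - 1) (W + 4 - j) (K + 1), assemblyBlock F W K k (2 * W + 4) 2,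
        reservoirBlock W r (3 * W + 5) 6] := by
  have hs := slot_east (F := F) (K := K) (x := W + 4 - j) (n := 0) (t := K - k - 1) (j := j)
    (by omega) (by omega) hW
  have hQ := queue_east (r := r) (q := q) (K := K) (x := 2 * W + 3 - q) (n :=
    0) (by omega) (by omega) hW
  have hA := assembly_static (F := F) (d := .E) (by simp) hW hk
  have hR := reservoir_static (d := .E) (by simp) hW hr
  refine Moves.of_lands_or_contact
    [(tileBlock a 3 (K + 1), W - j), (queueBlock W q r (2 * W + 3 - q) (K + 5), 0),
      (slotBlock F W j (K - k - 1) (W + 4 - j) (K + 1), 0), (assemblyBlock F W K k (2 * W + 4) 2,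
      0), (reservoirBlock W r (3 * W + 5) 6, 0)] rfl ?_ ?_ ?_ ?_
  · simp only [List.map_cons, List.map_nil, tileBlock, queueBlock, slotBlock, assemblyBlock,
      reservoirBlock, shift, Dir.vec, List.cons.injEq, Block.mk.injEq, and_true]
    omega
  · simp only [List.forall_mem_cons]
    exact ⟨tile_pack_east hW hj, hQ.1, hs.1, hA.1, hR.1, by simp⟩
  · simp only [List.pairwise_cons, List.forall_mem_cons]
    refine ⟨⟨?_, ?p02, ?_, ?_, by simp⟩, ⟨?_, ?_, ?_, by simp⟩, ⟨?_, ?_, by simp⟩, ⟨?_, by simp⟩,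
      by simp, .nil⟩
    case p02 =>
      exact compatible_tile_slot
    all_goals
      refine compatible_of_apart ?_
      simp only [tileBlock, queueBlock, slotBlock, assemblyBlock, reservoirBlock, Apart]
      omega
  · rw [List.forall_mem_cons]
    refine ⟨?_, fun m hm => Or.inl ?_⟩
    -- The first tile stops at the end of the slot, every later one at the tile packed before it.
    · rcases Nat.eq_zero_or_pos j with rfl | h0
      · left
        intro i hi j' hj' hf
        rw [mem_machine_blocked]
        unfold MachineOpen
        simp only [tileBlock, cell, Dir.vec, Front] at *
        omega
      · refine Or.inr ⟨(slotBlock F W j (K - k - 1) (W + 4 - j) (K + 1), 0), by simp, by simp, ?_⟩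
        intro i hi j' hj' hf
        refine ⟨0, h0, 0, Nat.one_pos, ?_⟩
        simp only [tileBlock, slotBlock, cell, Dir.vec, Prod.mk.injEq] at *
        omega
    · revert m
      simp only [List.forall_mem_cons]
      exact ⟨hQ.2, hs.2, hA.2, hR.2, by simp⟩

end Machine
end TiltAssembly

/-! ### Recutting blocks; accepting or discarding one tile. -/

namespace TiltAssembly

open TiltAssembly.Configuration Block

section Blocks

variable {L : Type}

theorem blockTiles_cons (b : Block L) (bs : List (Block L)) :
    blockTiles (b :: bs) = b.tiles ∪ blockTiles bs := by
  ext t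
  simp [blockTiles]

theorem Block.tiles_eq_empty {b : Block L} (h : b.w = 0) : b.tiles = ∅ := by
  ext t
  simp only [tiles, Set.mem_ofPred_eq, Set.mem_empty_iff_false, iff_false]
  rintro ⟨i, j, hi, -⟩
  omega

/-- Cutting off the first column of a block. -/
theorem Block.tiles_eq_union_column {b b₁ b₂ : Block L} (hx₁ : b₁.x = b.x) (hy₁ : b₁.y = b.y)
    (hx₂ : b₂.x = b.x + 1) (hy₂ : b₂.y = b.y) (hw₁ : b₁.w = 1) (hw : b.w = b₂.w + 1)
    (hh₁ : b₁.h = b.h) (hh₂ : b₂.h = b.h) (hl₁ : ∀ j < b.h, b₁.lab 0 j = b.lab 0 j)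
    (hl₂ : ∀ i < b₂.w, ∀ j < b.h, b₂.lab i j = b.lab (i + 1) j) :
    b.tiles = b₁.tiles ∪ b₂.tiles := by
  ext t
  simp only [tiles, Set.mem_union, Set.mem_ofPred_eq, hx₁, hy₁, hx₂, hy₂, hw₁, hw, hh₁, hh₂]
  constructor
  · rintro ⟨i, j, hi, hj, rfl⟩
    rcases i with _ | i
    · exact Or.inl ⟨0, j, Nat.one_pos, hj, by rw [hl₁ j hj]⟩
    · refine Or.inr ⟨i, j, by omega, hj, ?_⟩
      rw [hl₂ i (by omega) j hj]
      congr 2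
      push_cast
      ring
  · rintro (⟨i, j, hi, hj, rfl⟩ | ⟨i, j, hi, hj, rfl⟩)
    · obtain rfl : i = 0 := by omega
      exact ⟨0, j, by omega, hj, by rw [hl₁ j hj]⟩
    · refine ⟨i + 1, j, by omega, hj, ?_⟩
      rw [hl₂ i hi j hj]
      congr 2
      push_cast
      ring

/-- Cutting a block of height `h₁ + h₂` into two blocks of the same width. -/
theorem Block.tiles_eq_union_rows {b b₁ b₂ : Block L} (hx₁ : b₁.x = b.x) (hy₁ : b₁.y = b.y)
    (hx₂ : b₂.x = b.x) (hy₂ : b₂.y = b.y + b₁.h) (hw₁ : b₁.w = b.w) (hw₂ : b₂.w = b.w)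
    (hh : b.h = b₁.h + b₂.h) (hl₁ : ∀ i < b.w, ∀ j < b₁.h, b₁.lab i j = b.lab i j)
    (hl₂ : ∀ i < b.w, ∀ j < b₂.h, b₂.lab i j = b.lab i (b₁.h + j)) :
    b.tiles = b₁.tiles ∪ b₂.tiles := by
  ext t
  simp only [tiles, Set.mem_union, Set.mem_ofPred_eq, hx₁, hy₁, hx₂, hy₂, hw₁, hw₂, hh]
  constructor
  · rintro ⟨i, j, hi, hj, rfl⟩
    rcases lt_or_ge j b₁.h with h | h
    · exact Or.inl ⟨i, j, hi, h, by rw [hl₁ i hi j h]⟩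
    · obtain ⟨j, rfl⟩ := Nat.exists_eq_add_of_le h
      refine Or.inr ⟨i, j, hi, by omega, ?_⟩
      rw [hl₂ i hi j (by omega)]
      congr 2
      push_cast
      ring
  · rintro (⟨i, j, hi, hj, rfl⟩ | ⟨i, j, hi, hj, rfl⟩)
    · exact ⟨i, j, hi, by omega, by rw [hl₁ i hi j hj]⟩
    · refine ⟨i, b₁.h + j, hi, by omega, ?_⟩
      rw [hl₂ i hi j hj]
      congr 2
      push_cast
      ring

end Blocks

section Machine

variable {W K : ℕ} {F : ℕ → ℕ → Bool} {q r j k : ℕ}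

/-- Two units carry the tile from `x = 2` to `x = 0`, off the board, while the queue slides one unit
over the hole. -/
theorem moves_discard_west {a : Bool} (hW : 0 < W) (hq : q < 2 * W) (hj : j ≤ W) (hk : k ≤ K)
    (hr : r ≤ 2 * K) :
    Moves (· && ·) (machine W K) [.W]
      [tileBlock a 2 (K + 3), queueBlock W q r 3 (K + 5), slotBlock F W j (K - k - 1) 3 (K + 1),
        assemblyBlock F W K k (2 * W + 4) 2, reservoirBlock W r (3 * W + 5) 6]
      [queueBlock W q r 2 (K + 5), slotBlock F W j (K - k - 1) 3 (K + 1),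
        assemblyBlock F W K k (2 * W + 4) 2, reservoirBlock W r (3 * W + 5) 6] := by
  have hQ := queue_west (r := r) (q := q) (K := K) (x := 3) (n := 1) (by omega) (by omega) hW
  have hs := slot_west (F := F) (K := K) (x := 3) (n := 0) (t := K - k - 1) (j := j)
    (by omega) (by omega) hW
  have hA := assembly_static (F := F) (d := .W) (by simp) hW hk
  have hR := reservoir_static (d := .W) (by simp) hW hr
  have hT : (tileBlock a 2 (K + 3)).cell .W 0 0 2 ∉ (machine W K).locations := by
    rw [mem_machine_locations]
    simp [tileBlock, cell, Dir.vec]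
  intro C hB hC
  obtain ⟨C', h1, h2, h3⟩ := Moves.of_glides (G := (· && ·)) (d := .W)
    [(tileBlock a 2 (K + 3), 2), (queueBlock W q r 3 (K + 5), 1),
      (slotBlock F W j (K - k - 1) 3 (K + 1), 0),
      (assemblyBlock F W K k (2 * W + 4) 2, 0), (reservoirBlock W r (3 * W + 5) 6, 0)]
    (by
      simp only [List.forall_mem_cons]
      refine ⟨Or.inl ⟨rfl, rfl, fun l hl => ?_, hT⟩, Or.inr hQ.1, Or.inr hs.1, Or.inr hA.1,
        Or.inr hR.1, by simp⟩
      rw [mem_machine_blocked]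
      unfold MachineOpen
      simp only [tileBlock, cell, Dir.vec]
      omega)
    (by
      simp only [List.pairwise_cons, List.forall_mem_cons]
      refine ⟨⟨?_, ?_, ?_, ?_, by simp⟩, ⟨?_, ?_, ?_, by simp⟩, ⟨?_, ?_, by simp⟩,
        ⟨?_, by simp⟩, by simp, .nil⟩
      all_goals
        refine compatible_of_apart ?_
        simp only [tileBlock, queueBlock, slotBlock, assemblyBlock, reservoirBlock, Apart]
        omega)
    (by
      simp only [List.forall_mem_cons]
      exact ⟨Or.inr (Or.inl ⟨hT, rfl, rfl⟩), Or.inl hQ.2, Or.inl hs.2, Or.inl hA.2, Or.inl hR.2,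
        by simp⟩) C hB hC
  refine ⟨C', h1, h2, h3.trans ?_⟩
  -- Restricting to the locations of the board erases the discarded tile and leaves the other blocks
  -- intact.
  have hin : ∀ m : Block Bool × ℕ, Glides (machine W K) .W m →
      (m.1.shift .W m.2).tiles ⊆ {t | t.1 ∈ (machine W K).locations} := by
    rintro m hm t ⟨i, j, hi, hj, rfl⟩
    have := (hm i hi j hj _ le_rfl).1
    simp only [cell] at this
    simp only [shift, Set.mem_ofPred_eq]
    convert this using 2 <;> ring
  have hout : ((tileBlock a 2 (K + 3)).shift .W 2).tiles ∩ {t | t.1 ∈ (machine W K).locations} =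
      ∅ := by
    rw [Set.eq_empty_iff_forall_notMem]
    rintro _ ⟨⟨i, j, hi, hj, rfl⟩, hl⟩
    have hl := mem_machine_locations.1 hl
    simp only [tileBlock, shift, Dir.vec] at hl hi
    omega
  simp only [List.map_cons, List.map_nil, blockTiles_cons, Set.union_inter_distrib_right, hout,
    Set.empty_union, Set.inter_eq_left.2 (hin _ hQ.1), Set.inter_eq_left.2 (hin _ hs.1),
    Set.inter_eq_left.2 (hin _ hA.1), Set.inter_eq_left.2 (hin _ hR.1)]
  simp [blockTiles, queueBlock, slotBlock, assemblyBlock, reservoirBlock, shift, Dir.vec]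

theorem blockTiles_queue (bs : List (Block Bool)) {x y : ℤ} (hq : q < 2 * W) :
    blockTiles (queueBlock W (q + 1) r x y :: bs) =
      blockTiles (tileBlock (supply (2 * W - (q + 1)) r) x y ::
        queueBlock W q r (x + 1) y :: bs) := by
  simp only [blockTiles_cons, ← Set.union_assoc]
  congr 1
  refine Block.tiles_eq_union_column rfl rfl rfl rfl rfl rfl rfl rfl (fun _ _ => rfl) ?_
  intro i hi j hj
  simp only [queueBlock]
  congr 1
  omega

theorem blockTiles_slot (bs : List (Block Bool)) {b : Block Bool} {t : ℕ} {x y : ℤ} (hj : j < W) :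
    blockTiles (tileBlock (F (W - j - 1) t) x y :: b :: slotBlock F W j t (x + 1) y :: bs) =
      blockTiles (b :: slotBlock F W (j + 1) t x y :: bs) := by
  simp only [blockTiles_cons, ← Set.union_assoc]
  rw [Set.union_comm _ b.tiles, Set.union_assoc b.tiles]
  congr 2
  symm
  refine Block.tiles_eq_union_column rfl rfl rfl rfl rfl rfl rfl rfl (fun _ _ => ?_) ?_
  · simp only [tileBlock, slotBlock]
    congr 1
  · intro i hi j' hj'
    simp only [slotBlock]
    congr 1
    omega

theorem moves_first_tile (hK : 0 < K) (hW : 0 < W) (hq : q < 2 * W) (hj : j ≤ W) (hk : k ≤ K)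
    (hr : r ≤ 2 * K) :
    Moves (· && ·) (machine W K) [.W, .S] (machineState F W K (q + 1) r j k)
      [tileBlock (supply (2 * W - (q + 1)) r) 2 (K + 3), queueBlock W q r 3 (K + 5),
        slotBlock F W j (K - k - 1) 3 (K + 1), assemblyBlock F W K k (2 * W + 4) 2,
        reservoirBlock W r (3 * W + 5) 6] := by
  refine (moves_west hW (by omega) hj hk hr).trans
    ((moves_release hK hW hq hj hk hr ?_).congr_left (blockTiles_queue _ hq))
  -- The released tile and its successor have consecutive column indices in the supply row, so they
  -- are not both sticky.
  have := supply_eq_false_of_succ (2 * W - (q + 1)) r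
  rwa [show 2 * W - (q + 1) + 1 = 2 * W - q by omega] at this

/-- The first tile of the queue is removed from the board. -/
theorem moves_discard (hK : 0 < K) (hW : 0 < W) (hq : q < 2 * W) (hj : j ≤ W) (hk : k ≤ K)
    (hr : r ≤ 2 * K) :
    Moves (· && ·) (machine W K) [.W, .S, .W, .E] (machineState F W K (q + 1) r j k)
      (machineState F W K q r j k) :=
  (moves_first_tile hK hW hq hj hk hr).trans
    ((moves_discard_west hW hq hj hk hr).trans (moves_discard_east hW hq hj hk hr))

/-- The first tile of the queue is added to the slot. -/
theorem moves_accept (hK : 0 < K) (hW : 0 < W) (hq : q < 2 * W) (hj : j < W) (hk : k ≤ K)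
    (hr : r ≤ 2 * K) (hF : supply (2 * W - (q + 1)) r = F (W - j - 1) (K - k - 1)) :
    Moves (· && ·) (machine W K) [.W, .S, .E, .S, .E] (machineState F W K (q + 1) r j k)
      (machineState F W K q r (j + 1) k) := by
  refine (moves_first_tile hK hW hq hj.le hk hr).trans
    ((moves_accept_east hW hq hj.le hk hr).trans ((moves_accept_south hK hW hq hj hk hr).trans
      ((moves_accept_pack hW hq hj hk hr).congr_right ?_)))
  have := blockTiles_slot (F := F) [assemblyBlock F W K k (2 * W + 4) 2,
    reservoirBlock W r (3 * W + 5) 6] (b := queueBlock W q r (2 * W + 3 - q) (K + 5))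
    (t := K - k - 1) (x := W + 3 - j) (y := K + 1) hj
  rw [hF]
  rw [show (W + 3 - j + 1 : ℤ) = W + 4 - j by ring] at this
  rw [this, machineState]
  congr 4
  push_cast
  ring

end Machine
end TiltAssembly

/-! ### Delivering a row and supplying the next one. -/

namespace TiltAssembly

open TiltAssembly.Configuration Block

section Machine

variable {W K : ℕ} {F : ℕ → ℕ → Bool} {q r j k t : ℕ}

theorem assembly_north {y : ℤ} {n : ℕ} (hy : 2 ≤ y) (hn : y + k + n = 2 * K + 3) (hW : 0 < W) :
    Glides (machine W K) .N (assemblyBlock F W K k (2 * W + 4) y, n) ∧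
    Lands (machine W K) .N (assemblyBlock F W K k (2 * W + 4) y, n) := by
  constructor
  · intro i hi j hj l hl
    refine mem_machine_openCells hW ?_
    iterate 8 refine Or.inr ?_
    simp only [assemblyBlock, cell, Dir.vec] at *
    omega
  · intro i hi j hj hf
    rw [mem_machine_blocked]
    unfold MachineOpen
    simp only [assemblyBlock, cell, Dir.vec, Front] at *
    omega

theorem assembly_south {n : ℕ} (hn : n + k ≤ 2 * K + 1) (hW : 0 < W) :
    Glides (machine W K) .S (assemblyBlock F W K k (2 * W + 4) (n + 2), n) ∧
    Lands (machine W K) .S (assemblyBlock F W K k (2 * W + 4) (n + 2), n) := by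
  constructor
  · intro i hi j hj l hl
    refine mem_machine_openCells hW ?_
    iterate 8 refine Or.inr ?_
    simp only [assemblyBlock, cell, Dir.vec] at *
    omega
  · intro i hi j hj hf
    rw [mem_machine_blocked]
    unfold MachineOpen
    simp only [assemblyBlock, cell, Dir.vec, Front] at *
    omega

theorem assembly_east {y : ℤ} (hy : K + 3 ≤ y) (hn : y + k ≤ 2 * K + 3) (hW : 0 < W) :
    Glides (machine W K) .E (assemblyBlock F W K k (2 * W + 4) y, 0) ∧
    Lands (machine W K) .E (assemblyBlock F W K k (2 * W + 4) y, 0) := by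
  constructor
  · intro i hi j hj l hl
    refine mem_machine_openCells hW ?_
    iterate 8 refine Or.inr ?_
    simp only [assemblyBlock, cell, Dir.vec] at *
    omega
  · intro i hi j hj hf
    rw [mem_machine_blocked]
    unfold MachineOpen
    simp only [assemblyBlock, cell, Dir.vec, Front] at *
    omega

/-- `K + 3 ≤ y` keeps the lifted rows above the opening of the delivery corridor in the west wall.
-/
theorem assembly_west {y : ℤ} (hy : K + 3 ≤ y) (hn : y + k ≤ 2 * K + 3) (hW : 0 < W) :
    Glides (machine W K) .W (assemblyBlock F W K k (2 * W + 4) y, 0) ∧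
    Lands (machine W K) .W (assemblyBlock F W K k (2 * W + 4) y, 0) := by
  constructor
  · intro i hi j hj l hl
    refine mem_machine_openCells hW ?_
    iterate 8 refine Or.inr ?_
    simp only [assemblyBlock, cell, Dir.vec] at *
    omega
  · intro i hi j hj hf
    rw [mem_machine_blocked]
    unfold MachineOpen
    simp only [assemblyBlock, cell, Dir.vec, Front] at *
    omega

theorem reservoir_north {y : ℤ} {n : ℕ} (hy : 6 ≤ y) (hn : y + r + n = 2 * K + 7) (hW : 0 < W) :
    Glides (machine W K) .N (reservoirBlock W r (3 * W + 5) y, n) ∧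
    Lands (machine W K) .N (reservoirBlock W r (3 * W + 5) y, n) := by
  constructor
  · intro i hi j hj l hl
    refine mem_machine_openCells hW ?_
    iterate 5 refine Or.inr ?_
    refine Or.inl ?_
    simp only [reservoirBlock, cell, Dir.vec] at *
    omega
  · intro i hi j hj hf
    rw [mem_machine_blocked]
    unfold MachineOpen
    simp only [reservoirBlock, cell, Dir.vec, Front] at *
    omega

theorem reservoir_south {n : ℕ} (hn : n + r ≤ 2 * K + 1) (hW : 0 < W) :
    Glides (machine W K) .S (reservoirBlock W r (3 * W + 5) (n + 6), n) ∧
    Lands (machine W K) .S (reservoirBlock W r (3 * W + 5) (n + 6), n) := by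
  constructor
  · intro i hi j hj l hl
    refine mem_machine_openCells hW ?_
    iterate 5 refine Or.inr ?_
    refine Or.inl ?_
    simp only [reservoirBlock, cell, Dir.vec] at *
    omega
  · intro i hi j hj hf
    rw [mem_machine_blocked]
    unfold MachineOpen
    simp only [reservoirBlock, cell, Dir.vec, Front] at *
    omega

theorem reservoir_east {y : ℤ} (hy : 6 ≤ y) (hn : y + r ≤ 2 * K + 7) (hW : 0 < W) :
    Glides (machine W K) .E (reservoirBlock W r (3 * W + 5) y, 0) ∧
    Lands (machine W K) .E (reservoirBlock W r (3 * W + 5) y, 0) := by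
  constructor
  · intro i hi j hj l hl
    refine mem_machine_openCells hW ?_
    iterate 5 refine Or.inr ?_
    refine Or.inl ?_
    simp only [reservoirBlock, cell, Dir.vec] at *
    omega
  · intro i hi j hj hf
    rw [mem_machine_blocked]
    unfold MachineOpen
    simp only [reservoirBlock, cell, Dir.vec, Front] at *
    omega

/-- The bound is one less than in `reservoir_east`: a row at height `2 * K + 6` would slide out
through the supply corridor. -/
theorem reservoir_west {y : ℤ} (hy : 6 ≤ y) (hn : y + r ≤ 2 * K + 6) (hW : 0 < W) :
    Glides (machine W K) .W (reservoirBlock W r (3 * W + 5) y, 0) ∧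
    Lands (machine W K) .W (reservoirBlock W r (3 * W + 5) y, 0) := by
  constructor
  · intro i hi j hj l hl
    refine mem_machine_openCells hW ?_
    iterate 5 refine Or.inr ?_
    refine Or.inl ?_
    simp only [reservoirBlock, cell, Dir.vec] at *
    omega
  · intro i hi j hj hf
    rw [mem_machine_blocked]
    unfold MachineOpen
    simp only [reservoirBlock, cell, Dir.vec, Front] at *
    omega

/-- Pushed to the east, the row starts at `x ≥ 4`, clear of the exit corridor, so the ceiling of the
delivery corridor stops it after one unit. -/
theorem slot_north (hj : j ≤ W) (hW : 0 < W) :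
    Glides (machine W K) .N (slotBlock F W j t (W + 4 - j) (K + 1), 1) ∧
    Lands (machine W K) .N (slotBlock F W j t (W + 4 - j) (K + 1), 1) := by
  constructor
  · intro i hi j' hj' l hl
    refine mem_machine_openCells hW ?_
    unfold MachineOpen
    simp only [slotBlock, cell, Dir.vec] at *
    interval_cases l <;> omega
  · intro i hi j' hj' hf
    rw [mem_machine_blocked]
    unfold MachineOpen
    simp only [slotBlock, cell, Dir.vec, Front] at *
    omega

theorem delivery_east (hj : j ≤ W) (hW : 0 < W) :
    Glides (machine W K) .E (slotBlock F W j t (W + 4 - j) (K + 2), 2 * W) ∧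
    Lands (machine W K) .E (slotBlock F W j t (W + 4 - j) (K + 2), 2 * W) := by
  constructor
  · intro i hi j' hj' l hl
    refine mem_machine_openCells hW ?_
    iterate 7 refine Or.inr ?_
    refine Or.inl ?_
    simp only [slotBlock, cell, Dir.vec] at *
    omega
  · intro i hi j' hj' hf
    rw [mem_machine_blocked]
    unfold MachineOpen
    simp only [slotBlock, cell, Dir.vec, Front] at *
    omega

theorem supply_west  (hW : 0 < W) :
    Glides (machine W K) .W (queueBlock W (2 * W) r (3 * W + 5) (2 * K + 6), 3 * W + 2) ∧
    Lands (machine W K) .W (queueBlock W (2 * W) r (3 * W + 5) (2 * K + 6), 3 * W + 2) := by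
  constructor
  · intro i hi j hj l hl
    refine mem_machine_openCells hW ?_
    iterate 4 refine Or.inr ?_
    refine Or.inl ?_
    simp only [queueBlock, cell, Dir.vec] at *
    omega
  · intro i hi j hj hf
    rw [mem_machine_blocked]
    unfold MachineOpen
    simp only [queueBlock, cell, Dir.vec, Front] at *
    omega

theorem supply_south  (hW : 0 < W) :
    Glides (machine W K) .S (queueBlock W (2 * W) r 3 (2 * K + 6), K + 1) ∧
    Lands (machine W K) .S (queueBlock W (2 * W) r 3 (2 * K + 6), K + 1) := by
  constructor
  · intro i hi j hj l hl
    refine mem_machine_openCells hW ?_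
    iterate 3 refine Or.inr ?_
    refine Or.inl ?_
    simp only [queueBlock, cell, Dir.vec] at *
    omega
  · intro i hi j hj hf
    rw [mem_machine_blocked]
    unfold MachineOpen
    simp only [queueBlock, cell, Dir.vec, Front] at *
    omega

theorem moves_lift (hW : 0 < W) (hj : j ≤ W) (hk : k < K) (hr : r ≤ 2 * K) :
    Moves (· && ·) (machine W K) [.N]
      [slotBlock F W j t (W + 4 - j) (K + 1),
        assemblyBlock F W K k (2 * W + 4) 2,
        reservoirBlock W r (3 * W + 5) 6]
      [slotBlock F W j t (W + 4 - j) (K + 2),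
        assemblyBlock F W K k (2 * W + 4) (2 * K + 3 - k),
        reservoirBlock W r (3 * W + 5) (2 * K + 7 - r)] := by
  refine Moves.of_lands
    [(slotBlock F W j t (W + 4 - j) (K + 1), 1),
      (assemblyBlock F W K k (2 * W + 4) 2, 2 * K + 1 - k),
      (reservoirBlock W r (3 * W + 5) 6, 2 * K + 1 - r)] rfl ?_ ?_ ?_
  · simp only [List.map_cons, List.map_nil, slotBlock, assemblyBlock, reservoirBlock,
      shift, Dir.vec, List.cons.injEq, Block.mk.injEq, and_true]
    omega
  · simp only [List.forall_mem_cons]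
    exact ⟨slot_north hj hW, assembly_north (by omega) (by omega) hW,
      reservoir_north (by omega) (by omega) hW, by simp⟩
  · simp only [List.pairwise_cons, List.forall_mem_cons]
    refine ⟨⟨?_, ?_, by simp⟩, ⟨?_, by simp⟩, by simp, .nil⟩
    all_goals
      refine compatible_of_apart ?_
      simp only [slotBlock, assemblyBlock, reservoirBlock, Apart]
      omega

/-- Since `k < K`, the lifted rows start at height at least `K + 4`, so the row arriving at height
`K + 2` passes them without contact. -/
theorem moves_deliver_east (hW : 0 < W) (hj : j ≤ W) (hk : k < K) (hr : r ≤ 2 * K) :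
    Moves (· && ·) (machine W K) [.E]
      [slotBlock F W j t (W + 4 - j) (K + 2),
        assemblyBlock F W K k (2 * W + 4) (2 * K + 3 - k),
        reservoirBlock W r (3 * W + 5) (2 * K + 7 - r)]
      [slotBlock F W j t (3 * W + 4 - j) (K + 2),
        assemblyBlock F W K k (2 * W + 4) (2 * K + 3 - k),
        reservoirBlock W r (3 * W + 5) (2 * K + 7 - r)] := by
  refine Moves.of_lands
    [(slotBlock F W j t (W + 4 - j) (K + 2), 2 * W),
      (assemblyBlock F W K k (2 * W + 4) (2 * K + 3 - k), 0),
      (reservoirBlock W r (3 * W + 5) (2 * K + 7 - r), 0)] rfl ?_ ?_ ?_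
  · simp only [List.map_cons, List.map_nil, slotBlock, assemblyBlock, reservoirBlock,
      shift, Dir.vec, List.cons.injEq, Block.mk.injEq, and_true]
    omega
  · simp only [List.forall_mem_cons]
    exact ⟨delivery_east hj hW, assembly_east (by omega) (by omega) hW,
      reservoir_east (by omega) (by omega) hW, by simp⟩
  · simp only [List.pairwise_cons, List.forall_mem_cons]
    refine ⟨⟨?_, ?_, by simp⟩, ⟨?_, by simp⟩, by simp, .nil⟩
    all_goals
      refine compatible_of_apart ?_
      simp only [slotBlock, assemblyBlock, reservoirBlock, Apart]
      omega

theorem compatible_row_assembly (hk : k < K) :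
    Compatible (· && ·) .N (slotBlock F W j t (3 * W + 4 - j) (K + 2), K - k)
      (assemblyBlock F W K k (2 * W + 4) (2 * K + 3 - k), 0) := by
  intro i hi j' hj' i' hi' j'' hj'' l
  simp only [slotBlock, assemblyBlock, cell, Dir.vec, grid_adj_iff, Prod.mk.injEq] at *
  omega

theorem row_north (hW : 0 < W) (hj : j ≤ W) (hk : k < K) :
    Glides (machine W K) .N (slotBlock F W j t (3 * W + 4 - j) (K + 2), K - k) := by
  intro i hi j' hj' l hl
  refine mem_machine_openCells hW ?_
  iterate 8 refine Or.inr ?_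
  simp only [slotBlock, cell, Dir.vec] at *
  omega

theorem moves_join (hW : 0 < W) (hj : j ≤ W) (hk : k < K) (hr : r ≤ 2 * K) :
    Moves (· && ·) (machine W K) [.N]
      [slotBlock F W j t (3 * W + 4 - j) (K + 2), assemblyBlock F W K k (2 * W + 4) (2 * K + 3 - k),
        reservoirBlock W r (3 * W + 5) (2 * K + 7 - r)]
      [slotBlock F W j t (3 * W + 4 - j) (2 * K + 2 - k),
        assemblyBlock F W K k (2 * W + 4) (2 * K + 3 - k),
        reservoirBlock W r (3 * W + 5) (2 * K + 7 - r)] := by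
  have hA := assembly_north (F := F) (K := K) (k := k) (y := 2 * K + 3 - k) (n := 0)
    (by omega) (by omega) hW
  have hR := reservoir_north (K := K) (r := r) (y := 2 * K + 7 - r) (n := 0)
    (by omega) (by omega) hW
  refine Moves.of_lands_or_contact
    [(slotBlock F W j t (3 * W + 4 - j) (K + 2), K - k),
      (assemblyBlock F W K k (2 * W + 4) (2 * K + 3 - k), 0),
      (reservoirBlock W r (3 * W + 5) (2 * K + 7 - r), 0)] rfl ?_ ?_ ?_ ?_
  · simp only [List.map_cons, List.map_nil, slotBlock, assemblyBlock, reservoirBlock,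
      shift, Dir.vec, List.cons.injEq, Block.mk.injEq, and_true]
    omega
  · simp only [List.forall_mem_cons]
    exact ⟨row_north hW hj hk, hA.1, hR.1, by simp⟩
  · simp only [List.pairwise_cons, List.forall_mem_cons]
    refine ⟨⟨?p01, ?_, by simp⟩, ⟨?_, by simp⟩, by simp, .nil⟩
    case p01 => exact compatible_row_assembly hk
    all_goals
      refine compatible_of_apart ?_
      simp only [slotBlock, assemblyBlock, reservoirBlock, Apart]
      omega
  · rw [List.forall_mem_cons]
    refine ⟨?_, fun m hm => Or.inl ?_⟩
    · rcases Nat.eq_zero_or_pos k with rfl | h0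
      · left
        intro i hi j' hj' hf
        rw [mem_machine_blocked]
        unfold MachineOpen
        simp only [slotBlock, cell, Dir.vec, Front] at *
        omega
      · refine Or.inr ⟨(assemblyBlock F W K k (2 * W + 4) (2 * K + 3 - k), 0), by simp, by simp, ?_⟩
        intro i hi j' hj' hf
        simp only [slotBlock] at hi hj'
        -- The row is aligned with the east wall, so its tile `i` lies below column `W - j + i` of
        -- the assembled rows.
        refine ⟨W - j + i, by simp only [assemblyBlock]; omega, 0, h0, ?_⟩
        simp only [slotBlock, assemblyBlock, cell, Dir.vec, Prod.mk.injEq] at *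
        omega
    · revert m
      simp only [List.forall_mem_cons]
      exact ⟨hA.2, hR.2, by simp⟩

/-- The blocks after a tilt to the north: `k` assembled rows and `r` rows of the reservoir. -/
def liftedState (F : ℕ → ℕ → Bool) (W K r k : ℕ) : List (Block Bool) :=
  [assemblyBlock F W K k (2 * W + 4) (2 * K + 3 - k),
    reservoirBlock W r (3 * W + 5) (2 * K + 7 - r)]

theorem blockTiles_machineState_zero : blockTiles (machineState F W K 0 r j k) =
    blockTiles [slotBlock F W j (K - k - 1) (W + 4 - j) (K + 1),
      assemblyBlock F W K k (2 * W + 4) 2,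
      reservoirBlock W r (3 * W + 5) 6] := by
  rw [machineState, blockTiles_cons, Block.tiles_eq_empty (by rfl), Set.empty_union]

theorem moves_deliver (hW : 0 < W) (hj : j ≤ W) (hk : k < K) (hr : r ≤ 2 * K) :
    Moves (· && ·) (machine W K) [.N, .E, .N] (machineState F W K 0 r j k)
      (slotBlock F W j (K - k - 1) (3 * W + 4 - j) (2 * K + 2 - k) :: liftedState F W K r k) :=
  ((moves_lift hW hj hk hr).trans ((moves_deliver_east hW hj hk hr).trans
    (moves_join hW hj hk hr))).congr_left blockTiles_machineState_zero

/-- A complete row leaves the slot and joins the assembled rows. -/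
theorem moves_deliver_full (hW : 0 < W) (hk : k < K) (hr : r ≤ 2 * K) :
    Moves (· && ·) (machine W K) [.N, .E, .N] (machineState F W K 0 r W k)
      (liftedState F W K r (k + 1)) := by
  refine (moves_deliver hW le_rfl hk hr).congr_right ?_
  simp only [liftedState, blockTiles_cons, ← Set.union_assoc]
  congr 2
  symm
  refine Block.tiles_eq_union_rows ?_ ?_ rfl ?_ rfl rfl ?_ ?_ ?_
  · simp only [slotBlock, assemblyBlock]; ring
  · simp only [slotBlock, assemblyBlock]; push_cast; ring
  · simp only [slotBlock, assemblyBlock]; push_cast; ring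
  · simp only [slotBlock, assemblyBlock]; ring
  · intro i hi j hj
    simp only [slotBlock, assemblyBlock] at *
    congr 1 <;> omega
  · intro i hi j hj
    simp only [slotBlock, assemblyBlock] at *
    congr 1
    omega

theorem moves_deliver_empty (hW : 0 < W) (hk : k < K) (hr : r ≤ 2 * K) :
    Moves (· && ·) (machine W K) [.N, .E, .N] (machineState F W K 0 r 0 k)
      (liftedState F W K r k) := by
  refine (moves_deliver hW (Nat.zero_le _) hk hr).congr_right ?_
  rw [blockTiles_cons, Block.tiles_eq_empty (by rfl), Set.empty_union]

/-- The sliding row passes over row `r - 1` at changing offsets; this is harmless because one of two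
consecutive rows is entirely sand. -/
theorem compatible_supply : Compatible (· && ·) .W
    (queueBlock W (2 * W) r (3 * W + 5) (2 * K + 6), 3 * W + 2)
    (reservoirBlock W r (3 * W + 5) (2 * K + 6 - r), 0) := by
  intro i hi j' hj' i' hi' j'' hj'' l
  simp only [queueBlock, reservoirBlock, cell, Dir.vec, grid_adj_iff, Prod.mk.injEq] at *
  refine ⟨fun h hatt => ?_, by omega, by omega⟩
  simp only [Attract, supply, Bool.and_eq_true, decide_eq_true_eq] at hatt
  omega

theorem moves_supply_west (hW : 0 < W) (hk : k ≤ K) (hr : r < 2 * K) :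
    Moves (· && ·) (machine W K) [.W]
      [queueBlock W (2 * W) r (3 * W + 5) (2 * K + 6),
        assemblyBlock F W K k (2 * W + 4) (2 * K + 3 - k),
        reservoirBlock W r (3 * W + 5) (2 * K + 6 - r)]
      [queueBlock W (2 * W) r 3 (2 * K + 6),
        assemblyBlock F W K k (2 * W + 4) (2 * K + 3 - k),
        reservoirBlock W r (3 * W + 5) (2 * K + 6 - r)] := by
  refine Moves.of_lands
    [(queueBlock W (2 * W) r (3 * W + 5) (2 * K + 6), 3 * W + 2),
      (assemblyBlock F W K k (2 * W + 4) (2 * K + 3 - k), 0),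
      (reservoirBlock W r (3 * W + 5) (2 * K + 6 - r), 0)] rfl ?_ ?_ ?_
  · simp only [List.map_cons, List.map_nil, queueBlock, assemblyBlock, reservoirBlock,
      shift, Dir.vec, List.cons.injEq, Block.mk.injEq, and_true]
    omega
  · simp only [List.forall_mem_cons]
    exact ⟨supply_west hW, assembly_west (by omega) (by omega) hW,
      reservoir_west (by omega) (by omega) hW, by simp⟩
  · simp only [List.pairwise_cons, List.forall_mem_cons]
    refine ⟨⟨?_, ?p02, by simp⟩, ⟨?_, by simp⟩, by simp, .nil⟩
    case p02 => exact compatible_supply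
    all_goals
      refine compatible_of_apart ?_
      simp only [queueBlock, assemblyBlock, reservoirBlock, Apart]
      omega

theorem moves_supply_south (hW : 0 < W) (hk : k ≤ K) (hr : r < 2 * K) :
    Moves (· && ·) (machine W K) [.S]
      [queueBlock W (2 * W) r 3 (2 * K + 6),
        assemblyBlock F W K k (2 * W + 4) ((2 * K + 1 - k : ℕ) + 2),
        reservoirBlock W r (3 * W + 5) ((2 * K - r : ℕ) + 6)]
      [queueBlock W (2 * W) r 3 (K + 5),
        assemblyBlock F W K k (2 * W + 4) 2,
        reservoirBlock W r (3 * W + 5) 6] := by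
  refine Moves.of_lands
    [(queueBlock W (2 * W) r 3 (2 * K + 6), K + 1),
      (assemblyBlock F W K k (2 * W + 4) ((2 * K + 1 - k : ℕ) + 2), 2 * K + 1 - k),
      (reservoirBlock W r (3 * W + 5) ((2 * K - r : ℕ) + 6), 2 * K - r)] rfl ?_ ?_ ?_
  · simp only [List.map_cons, List.map_nil, queueBlock, assemblyBlock, reservoirBlock,
      shift, Dir.vec, List.cons.injEq, Block.mk.injEq, and_true]
    omega
  · simp only [List.forall_mem_cons]
    exact ⟨supply_south hW, assembly_south (by omega) hW, reservoir_south (by omega) hW, by simp⟩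
  · simp only [List.pairwise_cons, List.forall_mem_cons]
    refine ⟨⟨?_, ?_, by simp⟩, ⟨?_, by simp⟩, by simp, .nil⟩
    all_goals
      refine compatible_of_apart ?_
      simp only [queueBlock, assemblyBlock, reservoirBlock, Apart]
      omega

/-- The last row of the reservoir enters the queue. -/
theorem moves_supply (hW : 0 < W) (hk : k ≤ K) (hr : r < 2 * K) :
    Moves (· && ·) (machine W K) [.W, .S] (liftedState F W K (r + 1) k)
      (machineState F W K (2 * W) r 0 k) := by
  have h1 := moves_supply_west (F := F) hW hk hr
  have h2 := moves_supply_south (F := F) hW hk hr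
  rw [show (((2 * K + 1 - k : ℕ) : ℤ) + 2) = 2 * K + 3 - k by omega,
    show (((2 * K - r : ℕ) : ℤ) + 6) = 2 * K + 6 - r by omega] at h2
  -- The top row of the lifted reservoir lies in the supply corridor and is treated as a full queue
  -- of its own.
  have hres : (reservoirBlock W (r + 1) (3 * W + 5) (2 * K + 7 - (r + 1 : ℕ))).tiles =
      (reservoirBlock W r (3 * W + 5) (2 * K + 6 - r)).tiles ∪
        (queueBlock W (2 * W) r (3 * W + 5) (2 * K + 6)).tiles := by
    refine Block.tiles_eq_union_rows rfl ?_ rfl ?_ rfl rfl rfl (fun _ _ _ _ => rfl) ?_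
    · simp only [reservoirBlock]; push_cast; ring
    · simp only [queueBlock, reservoirBlock]; push_cast; ring
    · intro i hi j hj
      simp only [queueBlock, reservoirBlock] at *
      congr 1 <;> omega
  have hslot : (slotBlock F W 0 (K - k - 1) (W + 4 - (0 : ℕ)) (K + 1)).tiles = ∅ :=
    Block.tiles_eq_empty rfl
  refine ((h1.trans h2).congr_left ?_).congr_right ?_
  · simp only [liftedState, blockTiles_cons, hres]
    ext t
    simp only [Set.mem_union]
    tauto
  · simp only [machineState, blockTiles_cons, hslot, Set.empty_union,
      show (2 * W + 3 - (2 * W : ℕ) : ℤ) = 3 by push_cast; ring]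

end Machine
end TiltAssembly

/-! ### Assembling all rows and counting tilts. -/

namespace TiltAssembly

open TiltAssembly.Configuration Block

section Machine

variable {W K : ℕ} {F : ℕ → ℕ → Bool} {r j k : ℕ}

/-- All tiles of the queue are removed from the board. -/
theorem exists_moves_discard_all (hK : 0 < K) (hW : 0 < W) (hj : j ≤ W) (hk : k ≤ K)
    (hr : r ≤ 2 * K) : ∀ q ≤ 2 * W, ∃ D : List Dir, D.length = 4 * q ∧
      Moves (· && ·) (machine W K) D (machineState F W K q r j k) (machineState F W K 0 r j k)
  | 0, _ => ⟨[], rfl, Moves.refl⟩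
  | q + 1, hq => by
    obtain ⟨D, hD, h⟩ := exists_moves_discard_all hK hW hj hk hr q (by omega)
    refine ⟨_, ?_, (moves_discard hK hW (by omega) hj hk hr).trans h⟩
    simp only [List.length_append, List.length_cons, List.length_nil, hD]
    omega

/-- One tile of every pair of tiles of the queue is selected, so that the row is completed. -/
theorem exists_moves_fill (hK : 0 < K) (hW : 0 < W) (hk : k ≤ K) (hr : r ≤ 2 * K)
    (hr₂ : r % 2 = 0) : ∀ p ≤ W, ∃ D : List Dir, D.length = 9 * p ∧
      Moves (· && ·) (machine W K) D (machineState F W K (2 * p) r (W - p) k)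
        (machineState F W K 0 r W k)
  | 0, _ => ⟨[], rfl, Moves.refl⟩
  | p + 1, hp => by
    obtain ⟨D, hD, h⟩ := exists_moves_fill hK hW hk hr hr₂ p (by omega)
    have hW' : W - p = W - (p + 1) + 1 := by omega
    rw [hW'] at h
    -- Each pair starts at an even column, so in an even row it is sand followed by sticky.
    have h₁ : supply (2 * W - (2 * p + 1 + 1)) r = false := by
      simp only [supply, decide_eq_false_iff_not]; omega
    have h₂ : supply (2 * W - (2 * p + 1)) r = true := by
      simp only [supply, decide_eq_true_eq]; omega
    cases hF : F (W - (W - (p + 1)) - 1) (K - k - 1)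
    · refine ⟨_, ?_, (moves_accept hK hW (q := 2 * p + 1) (by omega) (by omega) hk hr
        (h₁.trans hF.symm)).trans ((moves_discard hK hW (by omega) (by omega) hk hr).trans h)⟩
      simp only [List.length_append, List.length_cons, List.length_nil, hD]
      omega
    · refine ⟨_, ?_, (moves_discard hK hW (q := 2 * p + 1) (by omega) (by omega) hk hr).trans
        ((moves_accept hK hW (by omega) (by omega) hk hr (h₂.trans hF.symm)).trans h)⟩
      simp only [List.length_append, List.length_cons, List.length_nil, hD]
      omega

/-- The row in the slot is delivered and the next row is collected. -/
theorem exists_moves_row (hW : 0 < W) (hk : k + 1 < K) (hr : 2 * r + 2 ≤ 2 * K) :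
    ∃ D : List Dir, D.length = 17 * W + 10 ∧
      Moves (· && ·) (machine W K) D (machineState F W K 0 (2 * r + 2) W k)
        (machineState F W K 0 (2 * r) W (k + 1)) := by
  obtain ⟨D₁, hD₁, h₁⟩ := exists_moves_discard_all (F := F) (K := K) (r := 2 * r + 1) (k := k + 1)
    (by omega) hW (Nat.zero_le W) (by omega) (by omega) (2 * W) le_rfl
  obtain ⟨D₂, hD₂, h₂⟩ := exists_moves_fill (F := F) (K := K) (r := 2 * r) (k := k + 1)
    (by omega) hW (by omega) (by omega) (by omega) W le_rfl
  rw [Nat.sub_self] at h₂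
  refine ⟨_, ?_, (moves_deliver_full hW (by omega) (by omega)).trans
    ((moves_supply hW (by omega) (by omega)).trans (h₁.trans
    ((moves_deliver_empty hW (by omega) (by omega)).trans
    ((moves_supply hW (by omega) (by omega)).trans h₂))))⟩
  -- The cost is `3 + 2` tilts to deliver and fetch the sand row, `4 * (2 * W)` to discard it, `3 +
  -- 2` to fetch the next row and `9 * W` to select from it.
  simp only [List.length_append, List.length_cons, List.length_nil, hD₁, hD₂]
  omega

theorem exists_moves_rows (hW : 0 < W) : ∀ r k, r + k + 1 = K → ∃ D : List Dir,
    D.length = r * (17 * W + 10) ∧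
      Moves (· && ·) (machine W K) D (machineState F W K 0 (2 * r) W k)
        (machineState F W K 0 0 W (r + k))
  | 0, _, _ => ⟨[], by simp, by rw [Nat.zero_add]; exact Moves.refl⟩
  | r + 1, k, hk => by
    obtain ⟨D₁, hD₁, h₁⟩ := exists_moves_row (F := F) (K := K) (r := r) (k := k) hW (by omega)
      (by omega)
    obtain ⟨D₂, hD₂, h₂⟩ := exists_moves_rows hW r (k + 1) (by omega)
    rw [← add_assoc, Nat.add_right_comm] at h₂
    refine ⟨_, ?_, h₁.trans h₂⟩
    rw [List.length_append, hD₁, hD₂]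
    ring

/-- The extra row, `K = H + 1`, is a dummy already in the slot at the start. Each of the `H` rounds
thus begins with a delivery, and one more delivery ends the process. -/
theorem exists_moves_assemble (hW : 0 < W) (H : ℕ) : ∃ D : List Dir,
    D.length = H * (17 * W + 10) + 3 ∧
      Moves (· && ·) (machine W (H + 1)) D (machineState F W (H + 1) 0 (2 * H) W 0)
        (liftedState F W (H + 1) 0 (H + 1)) := by
  obtain ⟨D, hD, h⟩ := exists_moves_rows (F := F) (K := H + 1) hW H 0 rfl
  refine ⟨_, ?_, h.trans (moves_deliver_full hW (by omega) (by omega))⟩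
  rw [List.length_append, hD]
  rfl

theorem Block.eq_of_mem_tiles {L : Type} {b : Block L} {s t : Tile L} (hs : s ∈ b.tiles)
    (ht : t ∈ b.tiles) (h : s.1 = t.1) : s = t := by
  obtain ⟨i, j, -, -, rfl⟩ := hs
  obtain ⟨i', j', -, -, rfl⟩ := ht
  simp only [Prod.mk.injEq, add_right_inj, Nat.cast_inj] at h
  obtain ⟨rfl, rfl⟩ := h
  rfl

theorem blockTiles_start (H : ℕ) : blockTiles (machineState F W (H + 1) 0 r W 0) =
    (slotBlock F W W H 4 (H + 2)).tiles ∪ (reservoirBlock W r (3 * W + 5) 6).tiles := by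
  have e : (W + 4 - W : ℤ) = 4 := by ring
  have e' : ((H + 1 : ℕ) + 1 : ℤ) = H + 2 := by push_cast; ring
  simp only [machineState, blockTiles_cons, e, e']
  rw [Block.tiles_eq_empty (b := queueBlock _ _ _ _ _) rfl]
  have : (assemblyBlock F W (H + 1) 0 (2 * W + 4) 2).tiles = ∅ := by
    ext t
    simp [Block.tiles, assemblyBlock]
  rw [this]
  simp [blockTiles]

/-- The initial configuration for target shapes in a box of size `W × H`. -/
def start (W H : ℕ) (hW : 0 < W) : Configuration (· && ·) where
  board := machine W (H + 1)
  -- The only target row present is the sand dummy, so the configuration does not depend on the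
  -- shape; each row to be built has two reservoir rows.
  tiles := blockTiles (machineState (fun _ _ => false) W (H + 1) 0 (2 * H) W 0)
  mem_open := by
    rintro t ht
    rw [blockTiles_start] at ht
    rcases ht with ⟨i, j, hi, hj, rfl⟩ | ⟨i, j, hi, hj, rfl⟩
    · have := (slot_east (F := fun _ _ => false) (K := H + 1) (x := 4) (n := 0) (t := H) (j := W)
        (by omega) (by omega) hW).1 i hi j hj 0 le_rfl
      simp only [slotBlock, cell, Dir.vec] at *
      convert this using 2 <;> push_cast <;> ring
    · have := (reservoir_static (K := H + 1) (r := 2 * H) (d := .E) (by simp) hW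
        (by omega)).1 i hi j hj 0 le_rfl
      simp only [reservoirBlock, cell, Dir.vec] at *
      convert this using 2 <;> push_cast <;> ring
  no_overlap := by
    intro s hs t ht h
    rw [blockTiles_start] at hs ht
    rcases hs with hs | hs <;> rcases ht with ht | ht
    · exact Block.eq_of_mem_tiles hs ht h
    · obtain ⟨i, j, hi, hj, rfl⟩ := hs
      obtain ⟨i', j', hi', hj', rfl⟩ := ht
      simp only [slotBlock, reservoirBlock, Prod.mk.injEq] at *
      omega
    · obtain ⟨i, j, hi, hj, rfl⟩ := hs
      obtain ⟨i', j', hi', hj', rfl⟩ := ht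
      simp only [slotBlock, reservoirBlock, Prod.mk.injEq] at *
      omega
    · exact Block.eq_of_mem_tiles hs ht h

end Machine

/-! ### From sticky tiles to the represented shape. -/

namespace Configuration

/-- If the sticky tiles form a translate of a shape, then the configuration weakly represents it. -/
theorem weaklyRepresents_of_sticky {C : Configuration (· && ·)} {u : Set Cell} {v : Cell}
    (hu : IsShape u) (hmem : ∀ p ∈ u, (p + v, true) ∈ C.tiles)
    (hsticky : ∀ c, (c, true) ∈ C.tiles → ∃ p ∈ u, c = p + v) : C.WeaklyRepresents u := by
  obtain ⟨p₀, hp₀⟩ := hu.nonempty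
  let f : grid.induce u →g C.bondGraph :=
    { toFun := fun p => (p.1 + v, true)
      map_rel' := by
        rintro ⟨p, hp⟩ ⟨q, hq⟩ h
        refine ⟨hmem p hp, hmem q hq, ?_, by simp [Attract]⟩
        have h : grid.Adj p q := h
        rw [grid_adj_iff] at h ⊢
        simp only [Prod.fst_add, Prod.snd_add]
        omega }
  have hreach : ∀ p ∈ u, C.bondGraph.Reachable (p₀ + v, true) (p + v, true) := fun p hp =>
    (hu.preconnected ⟨p₀, hp₀⟩ ⟨p, hp⟩).map f
  have hlabel : ∀ s t, C.bondGraph.Adj s t → s.2 = true ∧ t.2 = true := by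
    rintro s t ⟨-, -, -, h⟩
    simpa [Attract] using h.1
  have hP := mem_polyominoes_of_mem (hmem p₀ hp₀)
  refine ⟨_, hP, ⟨v, ?_⟩, ?_⟩
  · ext c
    constructor
    · rintro ⟨⟨c, b⟩, hs, rfl⟩
      have hb : b = true := forall_mem_polyomino (φ := fun s => s.2 = true)
        (fun s t h _ => (hlabel s t h).2) hP (SimpleGraph.Reachable.refl _) hs rfl
      subst hb
      obtain ⟨p, hp, rfl⟩ := hsticky c (mem_tiles_of_mem hP hs)
      exact ⟨p, hp, rfl⟩
    · rintro ⟨p, hp, rfl⟩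
      exact ⟨_, hreach p hp, rfl⟩
  · rintro Q ⟨⟨c, b⟩, ht, rfl⟩ hne
    cases b with
    | true =>
      obtain ⟨p, hp, rfl⟩ := hsticky c ht
      -- Connectedness of the shape puts all sticky tiles into the one polyomino.
      refine absurd ?_ hne
      ext s
      exact ⟨fun h => (hreach p hp).trans h, fun h => (hreach p hp).symm.trans h⟩
    | false =>
      refine ⟨(c, false), ?_, by simp [Attract]⟩
      ext s
      constructor
      · rintro ⟨w⟩
        cases w with
        | nil => rfl
        | cons e _ => exact absurd (hlabel _ _ e).1 (by simp)
      · rintro rfl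
        exact SimpleGraph.Reachable.refl _

theorem TiltSequence.reconfig {L : Type} {G : L → L → Bool} {C C' : Configuration G} :
    ∀ {D : List Dir}, D ≠ [] → TiltSequence D C C' → Reconfig C C'
  | [], h, _ => absurd rfl h
  | [d], _, ⟨C₁, h₁, h⟩ => by
    obtain rfl : C₁ = C' := h
    exact Relation.TransGen.single ⟨d, h₁⟩
  | d :: d' :: D, _, ⟨C₁, h₁, h⟩ =>
    Relation.TransGen.head ⟨d, h₁⟩ (TiltSequence.reconfig (by simp) h)

end Configuration

open scoped Classical in
theorem exists_tiltSequence_weaklyRepresents {W H : ℕ} (hW : 0 < W) {u : Set Cell}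
    (hu : u ∈ shapesInBox W H) : ∃ (D : List Dir) (C' : Configuration (· && ·)),
      D.length = H * (17 * W + 10) + 3 ∧ TiltSequence D (start W H hW) C' ∧
        C'.WeaklyRepresents u := by
  obtain ⟨hu, hbox⟩ := hu
  let F : ℕ → ℕ → Bool := fun i j => decide (((i : ℤ) + 1, (j : ℤ) + 1) ∈ u)
  obtain ⟨D, hD, h⟩ := exists_moves_assemble (F := F) hW H
  -- Row `H` of the target is the dummy: it lies above the box, hence is sand as in `start`.
  have hF : ∀ i, F i H = false := by
    intro i
    refine decide_eq_false fun h => ?_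
    have := (hbox h).2.2
    simp at this
  have hslot : (slotBlock (fun _ _ => false) W W H 4 (H + 2)).tiles =
      (slotBlock F W W H 4 (H + 2)).tiles := by
    simp only [slotBlock, hF]
  obtain ⟨C', hC, -, ht⟩ := h (start W H hW) rfl (by
    rw [blockTiles_start, ← hslot, ← blockTiles_start]; rfl)
  -- The finished rows have lower left corner `(2 * W + 4, H + 4)`, which corresponds to the point
  -- `(1, 1)` of the box.
  refine ⟨D, C', hD, hC, weaklyRepresents_of_sticky (v := (2 * W + 3, H + 3)) hu ?_ ?_⟩
  · intro p hp
    obtain ⟨⟨h1, h2⟩, h3, h4⟩ := hbox hp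
    rw [ht, liftedState, blockTiles_cons]
    refine Or.inl ⟨(p.1 - 1).toNat, (p.2 - 1).toNat, ?_, ?_, ?_⟩
    · simp only [assemblyBlock]; omega
    · simp only [assemblyBlock]; omega
    · have e1 : (((p.1 - 1).toNat : ℕ) : ℤ) = p.1 - 1 := by omega
      have e2 : (((p.2 - 1).toNat : ℕ) : ℤ) = p.2 - 1 := by omega
      have e3 : F (p.1 - 1).toNat (p.2 - 1).toNat = true := by
        refine decide_eq_true ?_
        rw [e1, e2, sub_add_cancel, sub_add_cancel]
        exact hp
      simp only [assemblyBlock, Nat.sub_self, Nat.zero_add, e1, e2, e3]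
      refine Prod.ext (Prod.ext ?_ ?_) rfl
      · simp only [Prod.fst_add]; ring
      · simp only [Prod.snd_add]; push_cast; ring
  · intro c hc
    rw [ht, liftedState, blockTiles_cons] at hc
    rcases hc with ⟨i, j, hi, hj, e⟩ | ⟨b, hb, hc⟩
    · simp only [assemblyBlock, Nat.sub_self, Nat.zero_add, Prod.mk.injEq] at e
      refine ⟨_, of_decide_eq_true e.2.symm, e.1.trans (Prod.ext ?_ ?_)⟩
      · simp only [Prod.fst_add]; ring
      · simp only [Prod.snd_add]; push_cast; ring
    · obtain rfl := List.mem_singleton.1 hb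
      obtain ⟨i, j, -, hj, -⟩ := hc
      exact absurd hj (Nat.not_lt_zero _)

end TiltAssembly

theorem mainTheorem2 :
    ∃ (L : Type) (_ : Finite L) (G : L → L → Bool) (c : ℕ),
      ∀ h w : ℕ, 0 < h → 0 < w →
        ∃ C : TiltAssembly.Configuration G,
          C.size ≤ c * (h * w) ∧
          C.WeaklyUniversal (TiltAssembly.shapesInBox h w) ∧
          ∀ u ∈ TiltAssembly.shapesInBox h w,
            ∃ (D : List TiltAssembly.Dir) (C' : TiltAssembly.Configuration G),
              D.length ≤ c * (h * w) ∧
              TiltAssembly.Configuration.TiltSequence D C C' ∧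
              C'.WeaklyRepresents u := by
  -- The first coordinate ranges up to `h`, so `h` is the row length. The board has at most `10 * h`
  -- columns and `11 * w` rows, whence `110`; `30` suffices for the tilts.
  refine ⟨Bool, inferInstance, (· && ·), 110, fun h w hh hw => ⟨TiltAssembly.start h w hh, ?_, ?_,
    ?_⟩⟩
  · change (5 * h + 5) * (2 * (w + 1) + 7) ≤ 110 * (h * w)
    calc (5 * h + 5) * (2 * (w + 1) + 7) ≤ (10 * h) * (11 * w) :=
      Nat.mul_le_mul (by omega) (by omega)
      _ = 110 * (h * w) := by ring
  · refine ⟨{C' | TiltAssembly.Configuration.Reconfig (TiltAssembly.start h w hh) C'},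
      fun u hu => ?_, fun C' hC' => hC'⟩
    obtain ⟨D, C', hD, hC, hr⟩ := TiltAssembly.exists_tiltSequence_weaklyRepresents hh hu
    -- `Reconfig` needs at least one tilt; the summand `3` in the length provides it.
    exact ⟨C', hC.reconfig (fun e => by simp [e] at hD), hr⟩
  · intro u hu
    obtain ⟨D, C', hD, hC, hr⟩ := TiltAssembly.exists_tiltSequence_weaklyRepresents hh hu
    refine ⟨D, C', ?_, hC, hr⟩
    rw [hD]
    calc w * (17 * h + 10) + 3 ≤ w * (27 * h) + 3 * (h * w) :=
          Nat.add_le_add (Nat.mul_le_mul_left _ (by omega))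
            (Nat.le_mul_of_pos_right 3 (Nat.mul_pos hh hw))
      _ = 30 * (h * w) := by ring
      _ ≤ 110 * (h * w) := Nat.mul_le_mul_right _ (by norm_num)
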